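/- **Setting.** Let $\mathcal N$ be a finite nonempty set of agents. Consider the primal problem: minimize $F(x)=\sum_{i\in\mathcal N} f_i(x_i)$ subject to $x_i\in\mathcal X_i\subset\mathbb R^{n_i}$ for all $i$, and $Ax=\sum_i A_ix_i\le b$, where $b\in\mathbb R^m$ and $A=(A_i)_{i\in\mathcal N}\in\mathbb R^{m\times n}$. Assume that each $\mathcal X_i$ is nonempty, compact and convex, that each $f_i$ is twice differentiable and $c_i$-strongly convex on $\mathcal X_i$ ($c_i>0$), and that some point of the relative interior of $\mathcal X=\prod_i\mathcal X_i$ satisfies $Ax\le b$. Put $c_F=\min_i c_i$, $L_D=\|A\|_F^2/c_F$, and for $\lambda\in\mathbb R^m$ $$D(\lambda)=\min_{x\in\mathcal X}\{F(x)+\langle\lambda,Ax-b\rangle\},\qquad \mathcal L_i(x_i;\lambda)=f_i(x_i)+\langle\lambda,A_ix_i\rangle,\qquad D_i(\lambda)=\min_{x_i\in\mathcal X_i}\mathcal L_i(x_i;\lambda).$$ Let $x^*$ be the optimal solution of the primal problem, $F^*=F(x^*)$; let $\lambda^*$ be an optimal solution of $\max_{\lambda\ge0}D(\lambda)$, $D^*=D(\lambda^*)$.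 Norms of vectors are Euclidean, and $[y]^+$ is the projection of $y$ onto the nonnegative orthant. **Algorithm.** Let $k_0\ge0$ be an integer, $\varepsilon_i\ge0$, $\varepsilon_D=\sum_i\varepsilon_i$, $\alpha>0$, $\lambda^0\ge0$. Time slots are $0,1,2,\dots$. The coordinator acts at the slots of a set $\mathcal K_D$ and agent $i$ at those of a set $\mathcal K_i$; each of these sets meets $\{\max(0,k-k_0),\dots,k\}$ for every slot $k$. If $k\in\mathcal K_i$, agent $i$ picks $\widetilde x_i^k\in\mathcal X_i$ with $|D_i(\lambda^{k-\delta})-\mathcal L_i(\widetilde x_i^k;\lambda^{k-\delta})|\le\varepsilon_i$ for a delay $\delta=\delta_{di}(k)$ with $0\le\delta\le\min(k_0,k)$; otherwise $\widetilde x_i^k=\widetilde x_i^{k-1}$. If $k\in\mathcal K_D$, then $\lambda^{k+1}=[\lambda^k+\alpha(A\widehat x^k-b)]^+$, where $\widehat x_i^k=\widetilde x_i^{k-\delta_{pi}(k)}$, $0\le\delta_{pi}(k)\le\min(k_0,k)$ and $k-\delta_{pi}(k)\in\mathcal K_i$; otherwise $\lambda^{k+1}=\lambda^k$. With $\mathcal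 K_D^k=\{\kappa\in\mathcal K_D:\kappa\le k\}$ put $$\bar x^k=\frac1{|\mathcal K_D^k|}\sum_{\kappa\in\mathcal K_D^k}\widehat x^\kappa,\qquad \bar\lambda^{k+1}=\frac1{|\mathcal K_D^k|}\sum_{\kappa\in\mathcal K_D^k}\lambda^{\kappa+1}.$$ **Theorem.** Suppose $0<\alpha<\min\left\{\frac1{(2k_0+1/2)L_D},\frac1{2L_D}\right\}$ (with $1/0=+\infty$). Let $D^0=D(\lambda^0)$, $\gamma_\alpha=\frac1\alpha-(2k_0+\frac12)L_D$ and $$M_{1/2}=\frac{k_0+1}{\alpha}\left(2\sqrt{\alpha\varepsilon_D}+\frac{2\sqrt{k_0L_D\varepsilon_D}}{\gamma_\alpha}\right),\qquad M_1=\frac{k_0+1}\alpha\left(2\|\lambda^*\|+\|\lambda^0\|+2\sqrt{\frac{2k_0(D^*-D^0)}{\gamma_\alpha}}\right),$$ $$N_0=2\varepsilon_D+\frac{2k_0(k_0+1)L_D\varepsilon_D}{\alpha\gamma_\alpha^2},\qquad N_{1/2}=\frac{4k_0(k_0+1)\sqrt{2L_D\varepsilon_D(D^*-D^0)}}{\alpha\gamma_\alpha^{3/2}},$$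 $$N_1=\frac{k_0+1}{2\alpha}\left(\|\lambda^0\|^2+\frac{8k_0(D^*-D^0)}{\gamma_\alpha}\right),\qquad N_1'=\frac{k_0+1}{2\alpha}\left(\|\lambda^0-\lambda^*\|^2+\frac{8k_0(D^*-D^0)}{\gamma_\alpha}\right).$$ Then for every slot $k\ge0$: a) $\displaystyle\|[A\bar x^k-b]^+\|\le\frac{M_{1/2}}{\sqrt{k+1}}+\frac{M_1}{k+1}$; b) $\displaystyle-\frac{M_{1/2}\|\lambda^*\|}{\sqrt{k+1}}-\frac{M_1\|\lambda^*\|}{k+1}\le F(\bar x^k)-F^*\le N_0+\frac{N_{1/2}}{\sqrt{k+1}}+\frac{N_1}{k+1}$; c) $\displaystyle0\le D^*-D(\bar\lambda^{k+1})\le N_0+\frac{N_{1/2}}{\sqrt{k+1}}+\frac{N_1'}{k+1}$; d) $\displaystyle\|\bar x^k-x^*\|^2\le\frac{2N_0}{c_F}+\frac{2(N_{1/2}+\|\lambda^*\|M_{1/2})}{c_F\sqrt{k+1}}+\frac{2(N_1+\|\lambda^*\|M_1)}{c_F(k+1)}$. -/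

import Mathlib

open scoped BigOperators RealInnerProductSpace

noncomputable section

namespace DualDecomp

/-- `d`-dimensional Euclidean space with the 2-norm. -/
abbrev Vec (d : ℕ) : Type := EuclideanSpace ℝ (Fin d)

/-- Aggregate decision vectors `x = col {x_i}`, with the 2-norm of the stacked vector. -/
abbrev Dec {ι : Type*} (n : ι → ℕ) : Type _ := PiLp 2 (fun i => Vec (n i))

/-- The projection of `y` onto the nonnegative orthant (entrywise positive part). -/
def proj {m : ℕ} (y : Vec m) : Vec m := WithLp.toLp 2 (fun j => max (y j) 0)

/-- `f` is twice differentiable over the set `s` (one-sided at the boundary, and relative to `s`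
if `s` has empty interior). -/
def TwiceDifferentiableOn {E : Type*} [NormedAddCommGroup E] [NormedSpace ℝ E]
    (f : E → ℝ) (s : Set E) : Prop :=
  ∃ f' : E → (E →L[ℝ] ℝ), (∀ x ∈ s, HasFDerivWithinAt f (f' x) s x) ∧ DifferentiableOn ℝ f' s

/-- Data of `min ∑ i, f i (x i)` subject to `x i ∈ X i` and `∑ i, A i x i ≤ b`; `A i` is the
`i`-th block of columns of the constraint matrix, `c i` the convexity modulus of `f i`. -/
structure Problem (ι : Type*) (m : ℕ) (n : ι → ℕ) where
  f : ∀ i, Vec (n i) → ℝ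
  X : ∀ i, Set (Vec (n i))
  A : ∀ i, Matrix (Fin m) (Fin (n i)) ℝ
  b : Vec m
  c : ι → ℝ

namespace Problem

variable {ι : Type*} [Fintype ι] {m : ℕ} {n : ι → ℕ} (P : Problem ι m n)

/-- `A_i x_i`. -/
def blockMul (i : ι) (x : Vec (n i)) : Vec m := WithLp.toLp 2 (Matrix.mulVec (P.A i) x.ofLp)

/-- `A x = ∑ i, A_i x_i`. -/
def mul (x : Dec n) : Vec m := ∑ i, P.blockMul i (x i)

/-- The aggregate feasible region, the product of the local ones. -/
def region : Set (Dec n) := {x | ∀ i, x i ∈ P.X i}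

/-- The constraint `A x ≤ b`. -/
def SatisfiesConstraint (x : Dec n) : Prop := ∀ j, P.mul x j ≤ P.b j

/-- The aggregate cost. -/
def F (x : Dec n) : ℝ := ∑ i, P.f i (x i)

/-- `min i, c i`. -/
def cF : ℝ := ⨅ i, P.c i

/-- Square of the Frobenius norm of the whole constraint matrix. -/
def frobSq : ℝ := ∑ i, ∑ r, ∑ s, (P.A i r s) ^ 2

/-- `L_D = ‖A‖_F² / c_F`. -/
def LD : ℝ := P.frobSq / P.cF

/-- Lagrangian of the problem. -/
def lagrangian (x : Dec n) (l : Vec m) : ℝ := P.F x + ⟪l, P.mul x - P.b⟫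

/-- Dual function: the minimum of the Lagrangian over the aggregate feasible region. -/
def D (l : Vec m) : ℝ := sInf ((fun x => P.lagrangian x l) '' P.region)

/-- Lagrangian of the subproblem of agent `i`. -/
def localLagrangian (i : ι) (x : Vec (n i)) (l : Vec m) : ℝ := P.f i x + ⟪l, P.blockMul i x⟫

/-- Optimal value of the subproblem of agent `i`. -/
def localD (i : ι) (l : Vec m) : ℝ := sInf ((fun x => P.localLagrangian i x l) '' P.X i)

/-- Standing assumption on the primal problem. The constraint qualification asks for a point of
the relative interior of the feasible region at which `A x ≤ b`; the constraints are affine. -/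
structure Regular : Prop where
  c_pos : ∀ i, 0 < P.c i
  strongConvex : ∀ i, StrongConvexOn (P.X i) (P.c i) (P.f i)
  twiceDifferentiable : ∀ i, TwiceDifferentiableOn (P.f i) (P.X i)
  nonempty : ∀ i, (P.X i).Nonempty
  compact : ∀ i, IsCompact (P.X i)
  convex : ∀ i, Convex ℝ (P.X i)
  slater : ∃ x ∈ intrinsicInterior ℝ P.region, P.SatisfiesConstraint x

/-- `x` is an optimal solution of the primal problem. -/
def IsPrimalOptimal (x : Dec n) : Prop :=
  x ∈ P.region ∧ P.SatisfiesConstraint x ∧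
    ∀ y ∈ P.region, P.SatisfiesConstraint y → P.F x ≤ P.F y

/-- `l` is an optimal solution of the dual problem. -/
def IsDualOptimal (l : Vec m) : Prop :=
  (∀ j, 0 ≤ l j) ∧ ∀ μ : Vec m, (∀ j, 0 ≤ μ j) → P.D μ ≤ P.D l

/-- `x` is an inexact solution, with tolerance `e`, of the subproblem of agent `i` at the
multiplier `l`. -/
def IsInexactSolution (i : ι) (e : ℝ) (l : Vec m) (x : Vec (n i)) : Prop :=
  x ∈ P.X i ∧ |P.localD i l - P.localLagrangian i x l| ≤ e

end Problem

/-- Local clocks of the coordinator and of the agents, and communication delays: `delayD i k` is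
the age of the multiplier that agent `i` uses at slot `k`, and `delayP i k` the age of the strategy
of agent `i` that the coordinator uses at slot `k`. -/
structure Schedule (ι : Type*) where
  KD : Set ℕ
  K : ι → Set ℕ
  delayD : ι → ℕ → ℕ
  delayP : ι → ℕ → ℕ

/-- Bounded asynchrony with parameter `k0`. Time slots are `0, 1, 2, …`, so an interval
`[k - k0, k]` is cut off at `0`, and the information used at a slot stems from no slot before `0`.
The strategy of agent `i` that the coordinator uses was computed at a slot of the clock of `i`. -/
structure Schedule.Bounded {ι : Type*} (T : Schedule ι) (k0 : ℕ) : Prop where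
  coordinator_acts : ∀ k, ∃ κ ∈ T.KD, κ ≤ k ∧ k ≤ κ + k0
  agent_acts : ∀ i k, ∃ κ ∈ T.K i, κ ≤ k ∧ k ≤ κ + k0
  delayD_le : ∀ i, ∀ k ∈ T.K i, T.delayD i k ≤ k0 ∧ T.delayD i k ≤ k
  delayP_le : ∀ i, ∀ k ∈ T.KD, T.delayP i k ≤ k0 ∧ T.delayP i k ≤ k
  computed : ∀ i, ∀ k ∈ T.KD, k - T.delayP i k ∈ T.K i

/-- The strategies `x̂^k` that the coordinator uses at slot `k`. -/
def received {ι : Type*} {n : ι → ℕ} (T : Schedule ι) (x : ℕ → Dec n) (k : ℕ) : Dec n :=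
  WithLp.toLp 2 (fun i => x (k - T.delayP i k) i)

/-- `lam` and `x` are the multipliers and the strategies `x̃` produced by the asynchronous, inexact
dual decomposition algorithm with step size `α`, tolerances `ε i` and schedule `T`. -/
structure IsRun {ι : Type*} [Fintype ι] {m : ℕ} {n : ι → ℕ} (P : Problem ι m n) (T : Schedule ι)
    (ε : ι → ℝ) (α : ℝ) (lam : ℕ → Vec m) (x : ℕ → Dec n) : Prop where
  init_nonneg : ∀ j, 0 ≤ lam 0 j
  solve : ∀ i, ∀ k ∈ T.K i, P.IsInexactSolution i (ε i) (lam (k - T.delayD i k)) (x k i)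
  keep : ∀ i k, k + 1 ∉ T.K i → x (k + 1) i = x k i
  update : ∀ k ∈ T.KD, lam (k + 1) = proj (lam k + α • (P.mul (received T x k) - P.b))
  idle : ∀ k, k ∉ T.KD → lam (k + 1) = lam k

open scoped Classical in
/-- The slots up to `k` at which the coordinator acts. -/
def slots {ι : Type*} (T : Schedule ι) (k : ℕ) : Finset ℕ :=
  (Finset.range (k + 1)).filter (fun κ => κ ∈ T.KD)

/-- The primal running average `x̄^k`. -/
def avgX {ι : Type*} {n : ι → ℕ} (T : Schedule ι) (x : ℕ → Dec n) (k : ℕ) : Dec n :=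
  (1 / ((slots T k).card : ℝ)) • ∑ κ ∈ slots T k, received T x κ

/-- The dual running average with superscript `k + 1`. -/
def avgLam {ι : Type*} {m : ℕ} (T : Schedule ι) (lam : ℕ → Vec m) (k : ℕ) : Vec m :=
  (1 / ((slots T k).card : ℝ)) • ∑ κ ∈ slots T k, lam (κ + 1)

/-! Constants of the bounds. In what follows `L` is `L_D`, `e` is `ε_D = ∑ i, ε i`, `gap` is
`D* - D⁰`, `ls` is the norm of `λ*`, `l0` the norm of `λ⁰` and `dist0` the norm of `λ⁰ - λ*`. -/

/-- `γ_α`. -/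
def gam (α k0 L : ℝ) : ℝ := 1 / α - (2 * k0 + 1 / 2) * L

/-- `M_{1/2}`. -/
def constMhalf (α k0 L e : ℝ) : ℝ :=
  (k0 + 1) / α * (2 * √(α * e) + 2 * √(k0 * L * e) / gam α k0 L)

/-- `M_1`. -/
def constM1 (α k0 L gap ls l0 : ℝ) : ℝ :=
  (k0 + 1) / α * (2 * ls + l0 + 2 * √(2 * k0 * gap / gam α k0 L))

/-- `N_0`. -/
def constN0 (α k0 L e : ℝ) : ℝ :=
  2 * e + 2 * k0 * (k0 + 1) * L * e / (α * gam α k0 L ^ 2)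

/-- `N_{1/2}`. -/
def constNhalf (α k0 L e gap : ℝ) : ℝ :=
  4 * k0 * (k0 + 1) * √(2 * L * e * gap) / (α * gam α k0 L ^ (3 / 2 : ℝ))

/-- `N_1`. -/
def constN1 (α k0 L gap l0 : ℝ) : ℝ :=
  (k0 + 1) / (2 * α) * (l0 ^ 2 + 8 * k0 * gap / gam α k0 L)

/-- `N_1'`. -/
def constN1' (α k0 L gap dist0 : ℝ) : ℝ :=
  (k0 + 1) / (2 * α) * (dist0 ^ 2 + 8 * k0 * gap / gam α k0 L)

end DualDecomp

end

/-! The algorithm is projected gradient ascent on the concave function `D`, whose gradient at λ is A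
Y(λ) - b with Y(λ) the minimizer of the Lagrangian. Delays and inexact solutions perturb this
gradient. A strategy used by the coordinator rests on a multiplier μ at most 2 k0 slots old, so ‖λ -
μ‖ is at most a window sum of step lengths. Strong convexity turns this into two estimates: the
gradient error is linear in the window sum (`norm_mul_sub_le`), and the excess of the Lagrangian
over `D` is quadratic in it (`lagrangian_inexact_le`), each up to a term from the tolerances.

The gradient estimate shows that a step increases `D` up to window terms. Summing, and using
Cauchy–Schwarz over the N slots at which the coordinator acts, bounds the sum S of squared steps: √S
≤ √(2 L ε_D N)/γ + √(gap/γ) (`sum_step_sq_le_sq`).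

The value estimate, put into the three-point inequality of the projection, bounds the summed gaps
between the Lagrangian at any l ≥ 0 and `D` by ‖λ⁰ - l‖², N ε_D and S (`sum_lagrangian_gap_le`). For
l = λ* the gaps are nonnegative. This yields both the dual bound, by concavity, and a bound on
‖λ^{k+1} - λ*‖. The latter controls infeasibility, since λ^{k+1} ≥ α N (A x̄ - b). For l = 0 the
Lagrangian is `F`, which gives the upper primal bound. Strong duality and strong convexity at λ*
give the lower primal bound and the distance to x*. Finally N ≥ (k+1)/(k0+1) turns rates in N into
rates in k+1, with constants fixed by `exists_weights`. -/

namespace DualDecomp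

/-! ### Perturbation of a strongly convex subproblem -/

section Agent

variable {E V : Type*} [NormedAddCommGroup E] [InnerProductSpace ℝ E]
  [NormedAddCommGroup V] [InnerProductSpace ℝ V]

theorem StrongConvexOn.add_sq_le_of_isMinOn {X : Set E} {c : ℝ} {g : E → ℝ}
    (hg : StrongConvexOn X c g) {x₀ : E} (hx₀ : x₀ ∈ X) (hmin : ∀ y ∈ X, g x₀ ≤ g y)
    {y : E} (hy : y ∈ X) : g x₀ + c / 2 * ‖y - x₀‖ ^ 2 ≤ g y := by
  by_contra! h
  set q := c / 2 * ‖y - x₀‖ ^ 2 with hq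
  set r := g y - g x₀ with hr
  have hr0 : 0 ≤ r := sub_nonneg.2 (hmin y hy)
  have hqr : r < q := by rw [hr]; linarith
  have hq0 : 0 < q := hr0.trans_lt hqr
  have key : ∀ s : ℝ, 0 < s → s ≤ 1 → q * (1 - s) ≤ r := by
    intro s hs hs1
    have h1 := hg.2 hy hx₀ hs.le (by linarith : 0 ≤ 1 - s) (by ring)
    have h2 := hmin _ (hg.1 hy hx₀ hs.le (by linarith : 0 ≤ 1 - s) (by ring))
    simp only [smul_eq_mul] at h1
    have h3 : s * (q * (1 - s)) ≤ s * r := by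
      rw [hq, hr]; nlinarith
    exact le_of_mul_le_mul_left h3 hs
  -- Letting s tend to 0 in `key` would give q ≤ r; this single s already suffices, because q (1 -
  -- s) = (q + r) / 2 > r.
  have h1 := key ((q - r) / (2 * q)) (by apply div_pos <;> linarith)
    (by rw [div_le_one (by linarith)]; linarith)
  have h2 : q * (1 - (q - r) / (2 * q)) = (q + r) / 2 := by field_simp; ring
  linarith

variable {X : Set E} {c a : ℝ} {f : E → ℝ} {B : E →ₗ[ℝ] V}

theorem strongConvexOn_add_inner (hf : StrongConvexOn X c f) (B : E →ₗ[ℝ] V) (l : V) :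
    StrongConvexOn X c (fun x => f x + ⟪l, B x⟫) := by
  refine ⟨hf.1, fun x hx y hy s t hs ht hst => ?_⟩
  have h := hf.2 hx hy hs ht hst
  simp only [smul_eq_mul, map_add, map_smul, inner_add_right, inner_smul_right] at h ⊢
  linarith

theorem norm_sub_minimizer_sq_le (hf : StrongConvexOn X c f) {l : V} {x₀ xh : E} {e : ℝ}
    (hx₀ : x₀ ∈ X) (hmin : ∀ y ∈ X, f x₀ + ⟪l, B x₀⟫ ≤ f y + ⟪l, B y⟫) (hxh : xh ∈ X)
    (he : f xh + ⟪l, B xh⟫ ≤ f x₀ + ⟪l, B x₀⟫ + e) : c / 2 * ‖xh - x₀‖ ^ 2 ≤ e := by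
  have := StrongConvexOn.add_sq_le_of_isMinOn (strongConvexOn_add_inner hf B l) hx₀ hmin hxh
  linarith

/-- Adding the quadratic growth of each problem, evaluated at the other's minimizer, cancels `f` and
leaves c ‖x - x'‖² ≤ ⟪l - l', B (x' - x)⟫. -/
theorem norm_minimizer_sub_minimizer_le (hf : StrongConvexOn X c f) (hc : 0 < c) (ha : 0 ≤ a)
    (hB : ∀ x, ‖B x‖ ≤ a * ‖x‖) {l l' : V} {x x' : E}
    (hx : x ∈ X) (hmin : ∀ y ∈ X, f x + ⟪l, B x⟫ ≤ f y + ⟪l, B y⟫)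
    (hx' : x' ∈ X) (hmin' : ∀ y ∈ X, f x' + ⟪l', B x'⟫ ≤ f y + ⟪l', B y⟫) :
    ‖x - x'‖ ≤ a / c * ‖l - l'‖ := by
  have h1 := StrongConvexOn.add_sq_le_of_isMinOn (strongConvexOn_add_inner hf B l) hx hmin hx'
  have h2 := StrongConvexOn.add_sq_le_of_isMinOn (strongConvexOn_add_inner hf B l') hx' hmin' hx
  rw [norm_sub_rev x' x] at h1
  have h3 : ⟪l - l', B (x' - x)⟫ ≤ ‖l - l'‖ * (a * ‖x - x'‖) := by
    refine (real_inner_le_norm _ _).trans ?_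
    gcongr
    rw [norm_sub_rev x x']
    exact hB _
  simp only [map_sub, inner_sub_left, inner_sub_right] at h3
  rcases (norm_nonneg (x - x')).eq_or_lt with h0 | h0
  · rw [← h0]; positivity
  · have h4 : ‖x - x'‖ * (c * ‖x - x'‖) ≤ ‖x - x'‖ * (a * ‖l - l'‖) := by nlinarith
    have h5 := le_of_mul_le_mul_left h4 h0
    rw [div_mul_eq_mul_div, le_div_iff₀ hc]
    linarith

/-- Passing from l to l' costs ⟪l' - l, B (xh - z)⟫, which is split at x₀. The part x₀ - z is
absorbed by the growth of the Lagrangian at x₀, leaving only a term quadratic in l' - l. -/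
theorem inexact_le_add (hf : StrongConvexOn X c f) (hc : 0 < c)
    (hB : ∀ x, ‖B x‖ ≤ a * ‖x‖) {l l' : V} {x₀ xh z : E} {e : ℝ}
    (hx₀ : x₀ ∈ X) (hmin : ∀ y ∈ X, f x₀ + ⟪l, B x₀⟫ ≤ f y + ⟪l, B y⟫)
    (he : f xh + ⟪l, B xh⟫ ≤ f x₀ + ⟪l, B x₀⟫ + e) (hz : z ∈ X) :
    f xh + ⟪l', B xh⟫ ≤ f z + ⟪l', B z⟫
      + (e + ‖l' - l‖ * (a * ‖xh - x₀‖) + a ^ 2 / (2 * c) * ‖l' - l‖ ^ 2) := by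
  have h1 := StrongConvexOn.add_sq_le_of_isMinOn (strongConvexOn_add_inner hf B l) hx₀ hmin hz
  have h2 : ⟪l' - l, B (xh - x₀)⟫ ≤ ‖l' - l‖ * (a * ‖xh - x₀‖) := by
    refine (real_inner_le_norm _ _).trans ?_
    gcongr
    exact hB _
  have h3 : ⟪l' - l, B (x₀ - z)⟫ ≤ ‖l' - l‖ * (a * ‖z - x₀‖) := by
    refine (real_inner_le_norm _ _).trans ?_
    gcongr
    rw [norm_sub_rev z]
    exact hB _
  simp only [map_sub, inner_sub_left, inner_sub_right] at h2 h3
  have h4 : ‖l' - l‖ * (a * ‖z - x₀‖)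
      ≤ c / 2 * ‖z - x₀‖ ^ 2 + a ^ 2 / (2 * c) * ‖l' - l‖ ^ 2 := by
    have : c / 2 * ‖z - x₀‖ ^ 2 + a ^ 2 / (2 * c) * ‖l' - l‖ ^ 2 - ‖l' - l‖ * (a * ‖z - x₀‖)
      = (c * ‖z - x₀‖ - a * ‖l' - l‖) ^ 2 / (2 * c) := by field_simp; ring
    have : 0 ≤ (c * ‖z - x₀‖ - a * ‖l' - l‖) ^ 2 / (2 * c) := by positivity
    linarith
  linarith

/-- Young's inequality removes the cross term between inexactness and delay. The weight t stays
free, to be balanced against the step size in `exists_weights`. -/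
theorem inexact_le_add_of_pos (hf : StrongConvexOn X c f) (hc : 0 < c)
    (hB : ∀ x, ‖B x‖ ≤ a * ‖x‖) {l l' : V} {x₀ xh z : E} {e t : ℝ} (ht : 0 < t)
    (hx₀ : x₀ ∈ X) (hmin : ∀ y ∈ X, f x₀ + ⟪l, B x₀⟫ ≤ f y + ⟪l, B y⟫) (hxh : xh ∈ X)
    (he : f xh + ⟪l, B xh⟫ ≤ f x₀ + ⟪l, B x₀⟫ + e) (hz : z ∈ X) :
    f xh + ⟪l', B xh⟫ ≤ f z + ⟪l', B z⟫
      + ((1 + 1 / t) * e + (1 + t) * (a ^ 2 / (2 * c) * ‖l' - l‖ ^ 2)) := by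
  have h1 := inexact_le_add hf hc hB (l' := l') hx₀ hmin he hz
  have h2 := norm_sub_minimizer_sq_le hf hx₀ hmin hxh he
  have h3 : ‖l' - l‖ * (a * ‖xh - x₀‖)
      ≤ c / 2 * ‖xh - x₀‖ ^ 2 / t + t * (a ^ 2 / (2 * c) * ‖l' - l‖ ^ 2) := by
    have : c / 2 * ‖xh - x₀‖ ^ 2 / t + t * (a ^ 2 / (2 * c) * ‖l' - l‖ ^ 2)
        - ‖l' - l‖ * (a * ‖xh - x₀‖)
      = (c * ‖xh - x₀‖ - t * (a * ‖l' - l‖)) ^ 2 / (2 * c * t) := by field_simp; ring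
    have : 0 ≤ (c * ‖xh - x₀‖ - t * (a * ‖l' - l‖)) ^ 2 / (2 * c * t) := by positivity
    linarith
  have h4 : c / 2 * ‖xh - x₀‖ ^ 2 / t ≤ e / t := by gcongr
  have h5 : (1 + 1 / t) * e = e + e / t := by ring
  linarith

end Agent

/-! ### The dual function: smoothness, gradient errors, strong duality -/

namespace Problem

variable {ι : Type*} [Fintype ι] {m : ℕ} {n : ι → ℕ} (P : Problem ι m n)

/-- The map `x ↦ A_i x` as a linear map. -/
def blockMap (i : ι) : Vec (n i) →ₗ[ℝ] Vec m where
  toFun := P.blockMul i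
  map_add' x y := by ext j; simp [blockMul, Matrix.mulVec_add]
  map_smul' s x := by ext j; simp [blockMul, Matrix.mulVec_smul]

omit [Fintype ι] in
theorem blockMap_apply (i : ι) (x : Vec (n i)) : P.blockMap i x = P.blockMul i x := rfl

/-- The Frobenius norm of `A_i`. -/
noncomputable def blockFrob (i : ι) : ℝ := √(∑ r, ∑ s, (P.A i r s) ^ 2)

omit [Fintype ι] in
theorem blockFrob_nonneg (i : ι) : 0 ≤ P.blockFrob i := Real.sqrt_nonneg _

omit [Fintype ι] in
theorem blockFrob_sq (i : ι) : P.blockFrob i ^ 2 = ∑ r, ∑ s, (P.A i r s) ^ 2 :=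
  Real.sq_sqrt (by positivity)

theorem sum_blockFrob_sq : ∑ i, P.blockFrob i ^ 2 = P.frobSq := by
  simp only [blockFrob_sq, frobSq]

omit [Fintype ι] in
theorem norm_blockMap_le (i : ι) (x : Vec (n i)) : ‖P.blockMap i x‖ ≤ P.blockFrob i * ‖x‖ := by
  refine le_of_sq_le_sq ?_ (by have := P.blockFrob_nonneg i; positivity)
  rw [mul_pow, blockFrob_sq, EuclideanSpace.real_norm_sq_eq, EuclideanSpace.real_norm_sq_eq,
    Finset.sum_mul]
  refine Finset.sum_le_sum fun r _ => ?_
  exact Finset.sum_mul_sq_le_sq_mul_sq Finset.univ (fun s => P.A i r s) x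

theorem mul_eq_sum (x : Dec n) : P.mul x = ∑ i, P.blockMap i (x i) := rfl

theorem lagrangian_eq (x : Dec n) (l : Vec m) :
    P.lagrangian x l = ∑ i, P.localLagrangian i (x i) l - ⟪l, P.b⟫ := by
  simp only [localLagrangian, lagrangian, mul_eq_sum, inner_sub_right, inner_sum, F,
    Finset.sum_add_distrib, blockMap_apply]
  ring

theorem lagrangian_sub (x : Dec n) (l l' : Vec m) :
    P.lagrangian x l - P.lagrangian x l' = ⟪P.mul x - P.b, l - l'⟫ := by
  rw [real_inner_comm, lagrangian, lagrangian, inner_sub_left]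
  ring

theorem lagrangian_zero (x : Dec n) : P.lagrangian x 0 = P.F x := by simp [lagrangian]

theorem cF_le (i : ι) : P.cF ≤ P.c i := ciInf_le (Set.finite_range _).bddBelow i

variable {P}

theorem Regular.cF_pos [Nonempty ι] (hP : P.Regular) : 0 < P.cF := by
  obtain ⟨i, hi⟩ := exists_eq_ciInf_of_finite (f := P.c)
  rw [cF, ← hi]
  exact hP.c_pos i

theorem frobSq_nonneg : 0 ≤ P.frobSq := by unfold frobSq; positivity

theorem Regular.LD_nonneg [Nonempty ι] (hP : P.Regular) : 0 ≤ P.LD :=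
  div_nonneg frobSq_nonneg hP.cF_pos.le

theorem Regular.sum_blockFrob_sq_div_le [Nonempty ι] (hP : P.Regular) :
    ∑ i, P.blockFrob i ^ 2 / P.c i ≤ P.LD := by
  rw [LD, ← sum_blockFrob_sq, Finset.sum_div]
  have := hP.cF_pos
  gcongr with i
  exact P.cF_le i

/-- `Y l` minimizes the Lagrangian at the multiplier `l`, block by block. -/
def IsMinimizer (P : Problem ι m n) (Y : Vec m → Dec n) : Prop :=
  ∀ l i, Y l i ∈ P.X i ∧ ∀ z ∈ P.X i,
    P.f i (Y l i) + ⟪l, P.blockMap i (Y l i)⟫ ≤ P.f i z + ⟪l, P.blockMap i z⟫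

theorem Regular.exists_isMinimizer (hP : P.Regular) : ∃ Y, P.IsMinimizer Y := by
  have h : ∀ (l : Vec m) (i : ι), ∃ y ∈ P.X i, ∀ z ∈ P.X i,
      P.f i y + ⟪l, P.blockMap i y⟫ ≤ P.f i z + ⟪l, P.blockMap i z⟫ := by
    intro l i
    obtain ⟨f', hf', -⟩ := hP.twiceDifferentiable i
    have hc : ContinuousOn (P.f i) (P.X i) := fun x hx => (hf' x hx).continuousWithinAt
    have hB : Continuous (P.blockMap i) := LinearMap.continuous_of_finiteDimensional _
    exact (hP.compact i).exists_isMinOn (hP.nonempty i)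
      (hc.add (continuous_const.inner hB).continuousOn)
  choose y hy hmin using h
  exact ⟨fun l => WithLp.toLp 2 (y l), fun l i => ⟨hy l i, hmin l i⟩⟩

variable {Y : Vec m → Dec n} (hY : P.IsMinimizer Y)
include hY

omit [Fintype ι] in
theorem IsMinimizer.mem_region (l : Vec m) : Y l ∈ P.region := fun i => (hY l i).1

theorem IsMinimizer.lagrangian_le {x : Dec n} (hx : x ∈ P.region) (l : Vec m) :
    P.lagrangian (Y l) l ≤ P.lagrangian x l := by
  rw [lagrangian_eq, lagrangian_eq]
  gcongr with i
  exact (hY l i).2 _ (hx i)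

theorem IsMinimizer.D_eq (l : Vec m) : P.D l = P.lagrangian (Y l) l := by
  refine IsLeast.csInf_eq ⟨⟨Y l, hY.mem_region l, rfl⟩, ?_⟩
  rintro _ ⟨x, hx, rfl⟩
  exact hY.lagrangian_le hx l

theorem IsMinimizer.D_le {x : Dec n} (hx : x ∈ P.region) (l : Vec m) :
    P.D l ≤ P.lagrangian x l := (hY.D_eq l).trans_le (hY.lagrangian_le hx l)

omit [Fintype ι] in
theorem IsMinimizer.localD_eq (l : Vec m) (i : ι) :
    P.localD i l = P.f i (Y l i) + ⟪l, P.blockMap i (Y l i)⟫ := by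
  refine IsLeast.csInf_eq ⟨⟨Y l i, (hY l i).1, rfl⟩, ?_⟩
  rintro _ ⟨x, hx, rfl⟩
  exact (hY l i).2 x hx

omit [Fintype ι] in
theorem IsMinimizer.le_of_isInexactSolution {i : ι} {e : ℝ} {l : Vec m} {x : Vec (n i)}
    (h : P.IsInexactSolution i e l x) :
    P.f i x + ⟪l, P.blockMap i x⟫ ≤ P.f i (Y l i) + ⟪l, P.blockMap i (Y l i)⟫ + e := by
  have h1 := (abs_le.1 h.2).1
  rw [hY.localD_eq] at h1
  change _ ≤ _ - (P.f i x + ⟪l, P.blockMap i x⟫) at h1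
  linarith

/-- Strong convexity of the Lagrangian. -/
theorem IsMinimizer.D_add_le (hP : P.Regular) {x : Dec n} (hx : x ∈ P.region)
    (l : Vec m) : P.D l + P.cF / 2 * ‖x - Y l‖ ^ 2 ≤ P.lagrangian x l := by
  rw [hY.D_eq, lagrangian_eq, lagrangian_eq, PiLp.norm_sq_eq_of_L2, Finset.mul_sum]
  have h : ∀ i, P.localLagrangian i (Y l i) l + P.cF / 2 * ‖(x - Y l) i‖ ^ 2
      ≤ P.localLagrangian i (x i) l := by
    intro i
    simp only [localLagrangian, ← blockMap_apply]
    have h1 := StrongConvexOn.add_sq_le_of_isMinOn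
      (strongConvexOn_add_inner (hP.strongConvex i) (P.blockMap i) l) (hY l i).1 (hY l i).2 (hx i)
    have h2 : P.cF / 2 * ‖x i - Y l i‖ ^ 2 ≤ P.c i / 2 * ‖x i - Y l i‖ ^ 2 := by
      gcongr
      exact P.cF_le i
    simp only [PiLp.sub_apply]
    linarith
  have h3 := Finset.sum_le_sum fun i (_ : i ∈ Finset.univ) => h i
  rw [Finset.sum_add_distrib] at h3
  linarith

/-- Smoothness of the dual function. -/
theorem IsMinimizer.lagrangian_le_D_add [Nonempty ι] (hP : P.Regular) (l l' : Vec m) :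
    P.lagrangian (Y l) l' ≤ P.D l' + P.LD / 2 * ‖l' - l‖ ^ 2 := by
  rw [hY.D_eq, lagrangian_eq, lagrangian_eq]
  have h : ∀ i, P.localLagrangian i (Y l i) l'
      ≤ P.localLagrangian i (Y l' i) l'
        + P.blockFrob i ^ 2 / P.c i * (‖l' - l‖ ^ 2 / 2) := by
    intro i
    simp only [localLagrangian, ← blockMap_apply]
    have h1 := inexact_le_add (hP.strongConvex i) (hP.c_pos i) (P.norm_blockMap_le i) (l' := l')
      (e := 0) (hY l i).1 (hY l i).2 (by rw [add_zero]) (hY l' i).1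
    simp only [sub_self, norm_zero, mul_zero, add_zero, zero_add] at h1
    refine h1.trans_eq ?_
    have := (hP.c_pos i).ne'
    field_simp
  have h3 := Finset.sum_le_sum fun i (_ : i ∈ Finset.univ) => h i
  rw [Finset.sum_add_distrib, ← Finset.sum_mul] at h3
  have h4 : (∑ i, P.blockFrob i ^ 2 / P.c i) * (‖l' - l‖ ^ 2 / 2) ≤ P.LD * (‖l' - l‖ ^ 2 / 2) := by
    gcongr
    exact hP.sum_blockFrob_sq_div_le
  linarith

/-- The Lagrangian at inexact minimizers for outdated multipliers. -/
theorem IsMinimizer.lagrangian_inexact_le [Nonempty ι] (hP : P.Regular) {ε : ι → ℝ} {xh : Dec n}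
    {μ : ι → Vec m} (hxh : ∀ i, P.IsInexactSolution i (ε i) (μ i) (xh i)) {l : Vec m} {W t : ℝ}
    (hW : ∀ i, ‖l - μ i‖ ≤ W) (ht : 0 < t) :
    P.lagrangian xh l
      ≤ P.D l + ((1 + 1 / t) * ∑ i, ε i + (1 + t) * (P.LD / 2 * W ^ 2)) := by
  rw [hY.D_eq, lagrangian_eq, lagrangian_eq]
  have h : ∀ i, P.localLagrangian i (xh i) l
      ≤ P.localLagrangian i (Y l i) l
        + ((1 + 1 / t) * ε i + P.blockFrob i ^ 2 / P.c i * ((1 + t) * (W ^ 2 / 2))) := by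
    intro i
    simp only [localLagrangian, ← blockMap_apply]
    refine (inexact_le_add_of_pos (hP.strongConvex i) (hP.c_pos i) (P.norm_blockMap_le i)
      (l' := l) ht (hY (μ i) i).1 (hY (μ i) i).2 (hxh i).1
      (hY.le_of_isInexactSolution (hxh i)) (hY l i).1).trans ?_
    have h0 := (hP.c_pos i)
    have h1 : (1 + t) * (P.blockFrob i ^ 2 / (2 * P.c i) * ‖l - μ i‖ ^ 2)
        ≤ (1 + t) * (P.blockFrob i ^ 2 / (2 * P.c i) * W ^ 2) := by
      gcongr
      exact hW i
    have h2 : (1 + t) * (P.blockFrob i ^ 2 / (2 * P.c i) * W ^ 2)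
      = P.blockFrob i ^ 2 / P.c i * ((1 + t) * (W ^ 2 / 2)) := by
      field_simp
    linarith
  have h3 := Finset.sum_le_sum fun i (_ : i ∈ Finset.univ) => h i
  rw [Finset.sum_add_distrib, Finset.sum_add_distrib, ← Finset.sum_mul, ← Finset.mul_sum] at h3
  have h4 : (∑ i, P.blockFrob i ^ 2 / P.c i) * ((1 + t) * (W ^ 2 / 2))
      ≤ P.LD * ((1 + t) * (W ^ 2 / 2)) := by
    gcongr
    exact hP.sum_blockFrob_sq_div_le
  linarith

/-- Deviation of the constraint values at inexact minimizers for outdated multipliers from the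
gradient of the dual function. -/
theorem IsMinimizer.norm_mul_sub_le [Nonempty ι] (hP : P.Regular) {ε : ι → ℝ}
    (hε : ∀ i, 0 ≤ ε i) {xh : Dec n}
    {μ : ι → Vec m} (hxh : ∀ i, P.IsInexactSolution i (ε i) (μ i) (xh i)) {l : Vec m} {W : ℝ}
    (hW : ∀ i, ‖l - μ i‖ ≤ W) :
    ‖P.mul (Y l) - P.mul xh‖ ≤ P.LD * W + √(2 * P.LD * ∑ i, ε i) := by
  have hW0 : 0 ≤ W := (norm_nonneg _).trans (hW (Classical.arbitrary ι))
  have hcF := hP.cF_pos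
  rw [mul_eq_sum, mul_eq_sum, ← Finset.sum_sub_distrib]
  have h : ∀ i, ‖P.blockMap i (Y l i) - P.blockMap i (xh i)‖
      ≤ P.blockFrob i ^ 2 / P.c i * W + P.blockFrob i * √(2 * ε i / P.cF) := by
    intro i
    have ha := P.blockFrob_nonneg i
    have hc := hP.c_pos i
    have h1 : ‖Y l i - Y (μ i) i‖ ≤ P.blockFrob i / P.c i * W :=
      (norm_minimizer_sub_minimizer_le (hP.strongConvex i) hc ha (P.norm_blockMap_le i)
        (hY l i).1 (hY l i).2 (hY (μ i) i).1 (hY (μ i) i).2).trans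
        (by have := hW i; gcongr)
    have h2 : ‖Y (μ i) i - xh i‖ ≤ √(2 * ε i / P.cF) := by
      have h3 := norm_sub_minimizer_sq_le (hP.strongConvex i) (hY (μ i) i).1 (hY (μ i) i).2
        (hxh i).1 (hY.le_of_isInexactSolution (hxh i))
      have h4 : P.cF / 2 * ‖xh i - Y (μ i) i‖ ^ 2 ≤ P.c i / 2 * ‖xh i - Y (μ i) i‖ ^ 2 := by
        gcongr
        exact P.cF_le i
      rw [norm_sub_rev]
      apply Real.le_sqrt_of_sq_le
      rw [le_div_iff₀ hcF]
      linarith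
    have h5 : ‖Y l i - xh i‖ ≤ P.blockFrob i / P.c i * W + √(2 * ε i / P.cF) :=
      (norm_sub_le_norm_sub_add_norm_sub _ (Y (μ i) i) _).trans (add_le_add h1 h2)
    rw [← map_sub]
    calc _ ≤ P.blockFrob i * ‖Y l i - xh i‖ := P.norm_blockMap_le i _
      _ ≤ P.blockFrob i * (P.blockFrob i / P.c i * W + √(2 * ε i / P.cF)) := by gcongr
      _ = _ := by ring
  refine (norm_sum_le _ _).trans ((Finset.sum_le_sum fun i _ => h i).trans ?_)
  rw [Finset.sum_add_distrib, ← Finset.sum_mul]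
  gcongr
  · exact hP.sum_blockFrob_sq_div_le
  -- Cauchy–Schwarz over the agents combines the block norms into the Frobenius norm and the
  -- tolerances into their sum.
  · apply Real.le_sqrt_of_sq_le
    refine (Finset.sum_mul_sq_le_sq_mul_sq _ _ _).trans_eq ?_
    have : ∀ i, √(2 * ε i / P.cF) ^ 2 = 2 * ε i / P.cF :=
      fun i => Real.sq_sqrt (by have := hε i; positivity)
    simp only [this]
    rw [sum_blockFrob_sq, LD, ← Finset.sum_div, ← Finset.mul_sum]
    ring

omit hY in
theorem inner_mul_sub_nonpos {x : Dec n} (hx : P.SatisfiesConstraint x) {l : Vec m}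
    (hl : ∀ j, 0 ≤ l j) : ⟪l, P.mul x - P.b⟫ ≤ 0 := by
  rw [PiLp.inner_apply]
  refine Finset.sum_nonpos fun j _ => ?_
  have h1 := hx j
  have h2 := hl j
  simp only [RCLike.inner_apply, conj_trivial, PiLp.sub_apply]
  exact mul_nonpos_of_nonpos_of_nonneg (by linarith) h2

/-- First-order optimality at λ*, without differentiating `D`: along the segment to μ, smoothness
and optimality give s q - s² r ≤ 0, hence q ≤ s r for all small s. -/
theorem IsMinimizer.inner_nonpos_of_isDualOptimal [Nonempty ι] (hP : P.Regular) {ls : Vec m}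
    (hls : P.IsDualOptimal ls) {μ : Vec m} (hμ : ∀ j, 0 ≤ μ j) :
    ⟪P.mul (Y ls) - P.b, μ - ls⟫ ≤ 0 := by
  by_contra! h
  set q := ⟪P.mul (Y ls) - P.b, μ - ls⟫ with hq
  have hL := hP.LD_nonneg
  set r := P.LD / 2 * ‖μ - ls‖ ^ 2 with hr
  have hr0 : 0 ≤ r := by positivity
  have key : ∀ s : ℝ, 0 < s → s ≤ 1 → q ≤ s * r := by
    intro s hs hs1
    have h1 := hY.lagrangian_le_D_add hP ls (ls + s • (μ - ls))
    have h2 := hls.2 (ls + s • (μ - ls)) fun j => by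
      have := hls.1 j
      have := hμ j
      simp only [PiLp.add_apply, PiLp.smul_apply, PiLp.sub_apply, smul_eq_mul]
      nlinarith
    have h3 := P.lagrangian_sub (Y ls) (ls + s • (μ - ls)) ls
    rw [← hY.D_eq] at h3
    rw [add_sub_cancel_left, norm_smul, mul_pow, Real.norm_eq_abs, sq_abs] at h1
    rw [add_sub_cancel_left, inner_smul_right] at h3
    have h4 : s * q ≤ s * (s * r) := by rw [hq, hr]; linarith
    exact le_of_mul_le_mul_left h4 hs
  have h1 := key (q / (2 * (q + r))) (by positivity)
    (by rw [div_le_one (by positivity)]; linarith)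
  have h2 : q / (2 * (q + r)) * r ≤ q / 2 := by
    rw [div_mul_eq_mul_div, div_le_div_iff₀ (by positivity) (by positivity)]
    nlinarith
  linarith

/-- The variational inequality at λ* is tested in the directions that matter: μ = λ* + e_j makes the
minimizer at λ* feasible, and μ = 0 gives the half of complementary slackness that bounds its cost
by D(λ*). -/
theorem IsMinimizer.strong_duality [Nonempty ι] (hP : P.Regular) {xs : Dec n} {ls : Vec m}
    (hxs : P.IsPrimalOptimal xs) (hls : P.IsDualOptimal ls) : P.D ls = P.F xs := by
  apply le_antisymm
  · have h1 := hY.D_le hxs.1 ls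
    have h2 := inner_mul_sub_nonpos hxs.2.1 hls.1
    rw [lagrangian] at h1
    linarith
  · have hfeas : P.SatisfiesConstraint (Y ls) := by
      intro j
      have h := hY.inner_nonpos_of_isDualOptimal hP hls (μ := ls + EuclideanSpace.single j 1)
        (fun i => by
          have := hls.1 i
          simp only [PiLp.add_apply, PiLp.single_apply]
          split_ifs <;> linarith)
      rw [add_sub_cancel_left, EuclideanSpace.inner_single_right] at h
      simp at h
      exact h
    have h1 := hY.inner_nonpos_of_isDualOptimal hP hls (μ := 0) (fun i => by simp)
    have h2 := P.lagrangian_sub (Y ls) 0 ls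
    rw [lagrangian_zero, ← hY.D_eq] at h2
    have h3 := hxs.2.2 _ (hY.mem_region ls) hfeas
    linarith

theorem IsMinimizer.eq_of_optimal [Nonempty ι] (hP : P.Regular) {xs : Dec n} {ls : Vec m}
    (hxs : P.IsPrimalOptimal xs) (hls : P.IsDualOptimal ls) : xs = Y ls := by
  have h1 := hY.D_add_le hP hxs.1 ls
  have h2 := inner_mul_sub_nonpos hxs.2.1 hls.1
  have h3 := hY.strong_duality hP hxs hls
  rw [lagrangian] at h1
  have h4 : P.cF / 2 * ‖xs - Y ls‖ ^ 2 ≤ P.cF / 2 * 0 := by linarith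
  have h5 := le_of_mul_le_mul_left h4 (half_pos hP.cF_pos)
  have h6 : ‖xs - Y ls‖ = 0 := by nlinarith [norm_nonneg (xs - Y ls)]
  exact sub_eq_zero.1 (norm_eq_zero.1 h6)

end Problem

end DualDecomp

namespace DualDecomp

/-! ### Projection onto the nonnegative orthant -/

section Projection

variable {m : ℕ}

theorem proj_nonneg (y : Vec m) (j : Fin m) : 0 ≤ proj y j := le_max_right _ _

theorem le_proj (y : Vec m) (j : Fin m) : y j ≤ proj y j := le_max_left _ _

theorem norm_proj_le_of_le {y z : Vec m} (hz : ∀ j, 0 ≤ z j) (h : ∀ j, y j ≤ z j) :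
    ‖proj y‖ ≤ ‖z‖ := by
  refine le_of_sq_le_sq ?_ (norm_nonneg _)
  rw [EuclideanSpace.real_norm_sq_eq, EuclideanSpace.real_norm_sq_eq]
  refine Finset.sum_le_sum fun j _ => ?_
  exact pow_le_pow_left₀ (proj_nonneg y j) (max_le (h j) (hz j)) 2

theorem inner_proj_sub_nonpos (y : Vec m) {l : Vec m} (hl : ∀ j, 0 ≤ l j) :
    ⟪proj y - y, proj y - l⟫ ≤ 0 := by
  rw [PiLp.inner_apply]
  refine Finset.sum_nonpos fun j _ => ?_
  have h := hl j
  simp only [proj, RCLike.inner_apply, conj_trivial, PiLp.sub_apply]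
  rcases le_total (y j) 0 with h0 | h0
  · rw [max_eq_right h0]; nlinarith
  · rw [max_eq_left h0]; simp

/-- Three-point inequality for a projected gradient step. -/
theorem norm_proj_sub_sq_le (v g : Vec m) (α : ℝ) {l : Vec m} (hl : ∀ j, 0 ≤ l j) :
    ‖proj (v + α • g) - l‖ ^ 2 + ‖proj (v + α • g) - v‖ ^ 2
      ≤ ‖v - l‖ ^ 2 + 2 * α * ⟪g, proj (v + α • g) - l⟫ := by
  have h := inner_proj_sub_nonpos (v + α • g) hl
  set p := proj (v + α • g)
  rw [← sub_sub, inner_sub_left, inner_smul_left, conj_trivial] at h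
  have h1 : v - l = (p - l) - (p - v) := by abel
  rw [h1, norm_sub_sq_real (p - l), real_inner_comm (p - v)]
  linarith

end Projection

/-! ### Sums over sliding windows: each index lies in boundedly many windows -/

theorem sum_window_le {g : ℕ → ℝ} (hg : ∀ j, 0 ≤ g j) (w K : ℕ) :
    ∑ k ∈ Finset.range K, ∑ j ∈ Finset.Ico (k - w) k, g j ≤ w * ∑ j ∈ Finset.range K, g j := by
  rw [Finset.sum_comm' (t' := Finset.range K)
    (s' := fun j => (Finset.Ico (j + 1) (j + w + 1)).filter (· < K))]
  · rw [Finset.mul_sum]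
    refine Finset.sum_le_sum fun j _ => ?_
    rw [Finset.sum_const, nsmul_eq_mul]
    refine mul_le_mul_of_nonneg_right ?_ (hg j)
    refine Nat.cast_le.2 ((Finset.card_filter_le _ _).trans ?_)
    rw [Nat.card_Ico]
    omega
  · intro k j
    simp only [Finset.mem_range, Finset.mem_Ico, Finset.mem_filter]
    omega

theorem sum_closed_window_le {g : ℕ → ℝ} (hg : ∀ j, 0 ≤ g j) (w K : ℕ) :
    ∑ k ∈ Finset.range K, ∑ j ∈ Finset.Ico (k - w) (k + 1), g j
      ≤ (w + 1) * ∑ j ∈ Finset.range K, g j := by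
  have h : ∀ k, ∑ j ∈ Finset.Ico (k - w) (k + 1), g j
      = ∑ j ∈ Finset.Ico (k - w) k, g j + g k :=
    fun k => Finset.sum_Ico_succ_top (Nat.sub_le k w) g
  simp only [h, Finset.sum_add_distrib]
  linarith [sum_window_le hg w K]

theorem sum_sq_closed_window_le (g : ℕ → ℝ) (w K : ℕ) :
    ∑ k ∈ Finset.range K, (∑ j ∈ Finset.Ico (k - w) (k + 1), g j) ^ 2
      ≤ ((w : ℝ) + 1) ^ 2 * ∑ j ∈ Finset.range K, g j ^ 2 := by
  have h : ∀ k, (∑ j ∈ Finset.Ico (k - w) (k + 1), g j) ^ 2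
      ≤ ((w : ℝ) + 1) * ∑ j ∈ Finset.Ico (k - w) (k + 1), g j ^ 2 := by
    intro k
    refine sq_sum_le_card_mul_sum_sq.trans ?_
    refine mul_le_mul_of_nonneg_right ?_ (Finset.sum_nonneg fun j _ => sq_nonneg _)
    rw [Nat.card_Ico]
    exact_mod_cast (by omega : k + 1 - (k - w) ≤ w + 1)
  refine (Finset.sum_le_sum fun k _ => h k).trans ?_
  rw [← Finset.mul_sum, pow_two, mul_assoc]
  exact mul_le_mul_of_nonneg_left (sum_closed_window_le (fun j => sq_nonneg (g j)) w K)
    (by positivity)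

/-- Each product is at most half the sum of the two squares; both halves contribute w / 2. -/
theorem sum_mul_window_le {g : ℕ → ℝ} (w K : ℕ) :
    ∑ k ∈ Finset.range K, g k * ∑ j ∈ Finset.Ico (k - w) k, g j
      ≤ w * ∑ j ∈ Finset.range K, g j ^ 2 := by
  have h : ∀ k, g k * ∑ j ∈ Finset.Ico (k - w) k, g j
      ≤ w / 2 * g k ^ 2 + 1 / 2 * ∑ j ∈ Finset.Ico (k - w) k, g j ^ 2 := by
    intro k
    have h1 : g k * ∑ j ∈ Finset.Ico (k - w) k, g j
        ≤ ∑ j ∈ Finset.Ico (k - w) k, (g k ^ 2 / 2 + 1 / 2 * g j ^ 2) := by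
      rw [Finset.mul_sum]
      refine Finset.sum_le_sum fun j _ => ?_
      nlinarith [sq_nonneg (g k - g j)]
    rw [Finset.sum_add_distrib, ← Finset.mul_sum, Finset.sum_const, nsmul_eq_mul,
      Nat.card_Ico] at h1
    have h2 : ((k - (k - w) : ℕ) : ℝ) * (g k ^ 2 / 2) ≤ w * (g k ^ 2 / 2) :=
      mul_le_mul_of_nonneg_right (by exact_mod_cast (by omega : k - (k - w) ≤ w)) (by positivity)
    linarith
  refine (Finset.sum_le_sum fun k _ => h k).trans ?_
  rw [Finset.sum_add_distrib, ← Finset.mul_sum, ← Finset.mul_sum]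
  linarith [sum_window_le (fun j => sq_nonneg (g j)) w K]

/-! ### Counting the coordinator's slots -/

section Slots

variable {ι : Type*} {T : Schedule ι} {k0 : ℕ}

theorem mem_slots {k κ : ℕ} : κ ∈ slots T k ↔ κ ≤ k ∧ κ ∈ T.KD := by
  simp [slots]

theorem slots_subset_range (T : Schedule ι) (k : ℕ) : slots T k ⊆ Finset.range (k + 1) :=
  fun _ h => Finset.mem_range_succ_iff.2 (mem_slots.1 h).1

/-- Send each slot to a coordinator slot at most k0 earlier; the fibre over κ lies in {κ, …, κ +
k0}. -/
theorem le_mul_card_slots (hT : T.Bounded k0) (k : ℕ) : k + 1 ≤ (k0 + 1) * (slots T k).card := by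
  choose f hf hfk hkf using hT.coordinator_acts
  have h := Finset.card_le_mul_card_image_of_maps_to (s := Finset.range (k + 1))
    (t := slots T k) (f := f)
    (fun j hj => mem_slots.2 ⟨(hfk j).trans (Nat.lt_succ_iff.1 (Finset.mem_range.1 hj)), hf j⟩)
    (k0 + 1) (fun κ _ => by
      refine (Finset.card_le_card (t := Finset.Ico κ (κ + k0 + 1)) fun j hj => ?_).trans ?_
      · have h1 := (Finset.mem_filter.1 hj).2
        have h2 := hfk j
        have h3 := hkf j
        rw [Finset.mem_Ico]
        omega
      · rw [Nat.card_Ico]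
        omega)
  rwa [Finset.card_range] at h

end Slots

/-! ### Dual ascent and summed Lagrangian gaps along a run -/

section Run

variable {ι : Type*} [Fintype ι] {m : ℕ} {n : ι → ℕ} {P : Problem ι m n} {k0 : ℕ}
  {T : Schedule ι} {ε : ι → ℝ} {α : ℝ} {lam : ℕ → Vec m} {x : ℕ → Dec n}

theorem IsRun.lam_nonneg (hrun : IsRun P T ε α lam x) (k : ℕ) (j : Fin m) : 0 ≤ lam k j := by
  induction k with
  | zero => exact hrun.init_nonneg j
  | succ k ih =>
    by_cases hk : k ∈ T.KD
    · rw [hrun.update k hk]; exact proj_nonneg _ j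
    · rw [hrun.idle k hk]; exact ih

/-- The slot of the multiplier on which the strategy of agent `i` received at slot `k` is based. -/
def source (T : Schedule ι) (k : ℕ) (i : ι) : ℕ :=
  k - T.delayP i k - T.delayD i (k - T.delayP i k)

omit [Fintype ι] in
theorem source_le (T : Schedule ι) (k : ℕ) (i : ι) : source T k i ≤ k := by
  unfold source; omega

omit [Fintype ι] in
theorem Schedule.Bounded.le_source (hT : T.Bounded k0) {k : ℕ} (hk : k ∈ T.KD) (i : ι) :
    k - 2 * k0 ≤ source T k i := by
  have h1 := hT.delayP_le i k hk
  have h2 := hT.delayD_le i _ (hT.computed i k hk)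
  unfold source; omega

theorem IsRun.received_inexact (hrun : IsRun P T ε α lam x) (hT : T.Bounded k0) {k : ℕ}
    (hk : k ∈ T.KD) (i : ι) :
    P.IsInexactSolution i (ε i) (lam (source T k i)) (received T x k i) :=
  hrun.solve i _ (hT.computed i k hk)

theorem IsRun.received_mem_region (hrun : IsRun P T ε α lam x) (hT : T.Bounded k0) {k : ℕ}
    (hk : k ∈ T.KD) : received T x k ∈ P.region :=
  fun i => (hrun.received_inexact hT hk i).1

theorem norm_sub_le_sum_Ico (lam : ℕ → Vec m) {a s k : ℕ} (has : a ≤ s) (hsk : s ≤ k) :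
    ‖lam k - lam s‖ ≤ ∑ j ∈ Finset.Ico a k, ‖lam (j + 1) - lam j‖ := by
  have h := dist_le_Ico_sum_dist lam hsk
  simp only [dist_eq_norm] at h
  rw [norm_sub_rev]
  refine h.trans ?_
  simp only [norm_sub_rev (lam _) (lam (_ + 1))]
  exact Finset.sum_le_sum_of_subset_of_nonneg (Finset.Ico_subset_Ico_left has)
    fun _ _ _ => norm_nonneg _

variable [Nonempty ι] {Y : Vec m → Dec n}

/-- The projection makes the inner product of the step with the perturbed gradient at least d² / α.
Replacing that gradient by the true one costs the window and tolerance terms, and smoothness of `D`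
costs L d² / 2. -/
theorem IsRun.D_ascent (hrun : IsRun P T ε α lam x) (hP : P.Regular) (hY : P.IsMinimizer Y)
    (hT : T.Bounded k0) (hε : ∀ i, 0 ≤ ε i) (hα : 0 < α) (k : ℕ) :
    P.D (lam k) + (1 / α - P.LD / 2) * ‖lam (k + 1) - lam k‖ ^ 2
      - P.LD * (‖lam (k + 1) - lam k‖
        * ∑ j ∈ Finset.Ico (k - 2 * k0) k, ‖lam (j + 1) - lam j‖)
      - √(2 * P.LD * ∑ i, ε i) * ‖lam (k + 1) - lam k‖ ≤ P.D (lam (k + 1)) := by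
  by_cases hk : k ∈ T.KD
  swap
  · rw [hrun.idle k hk]; simp
  set d := ‖lam (k + 1) - lam k‖ with hd
  set W := ∑ j ∈ Finset.Ico (k - 2 * k0) k, ‖lam (j + 1) - lam j‖
  have h1 := hY.lagrangian_le_D_add hP (lam k) (lam (k + 1))
  have h2 := P.lagrangian_sub (Y (lam k)) (lam (k + 1)) (lam k)
  rw [← hY.D_eq] at h2
  have h3 := hY.norm_mul_sub_le hP hε (hrun.received_inexact hT hk) (l := lam k) (W := W)
    (fun i => norm_sub_le_sum_Ico lam (hT.le_source hk i) (source_le T k i))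
  have h4 := norm_proj_sub_sq_le (lam k) (P.mul (received T x k) - P.b) α (hrun.lam_nonneg k)
  rw [← hrun.update k hk, ← hd, sub_self, norm_zero] at h4
  have h5 : ⟪P.mul (received T x k) - P.mul (Y (lam k)), lam (k + 1) - lam k⟫
      ≤ (P.LD * W + √(2 * P.LD * ∑ i, ε i)) * d := by
    refine (real_inner_le_norm _ _).trans ?_
    rw [norm_sub_rev (P.mul (received T x k))]
    gcongr
  have h6 : ⟪P.mul (received T x k) - P.mul (Y (lam k)), lam (k + 1) - lam k⟫
      = ⟪P.mul (received T x k) - P.b, lam (k + 1) - lam k⟫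
        - ⟪P.mul (Y (lam k)) - P.b, lam (k + 1) - lam k⟫ := by
    rw [← inner_sub_left]; congr 1; abel
  have h7 : 1 / α * d ^ 2 ≤ ⟪P.mul (received T x k) - P.b, lam (k + 1) - lam k⟫ := by
    rw [div_mul_eq_mul_div, one_mul, div_le_iff₀ hα]
    linarith
  linarith

/-- Here γ_α arises: 1/α - L/2 from each step, minus 2 k0 L from the summed products with the
windows. -/
theorem IsRun.sum_step_sq_le (hrun : IsRun P T ε α lam x) (hP : P.Regular)
    (hY : P.IsMinimizer Y) (hT : T.Bounded k0) (hε : ∀ i, 0 ≤ ε i) (hα : 0 < α) (K : ℕ) :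
    gam α k0 P.LD * ∑ j ∈ Finset.range K, ‖lam (j + 1) - lam j‖ ^ 2
      ≤ P.D (lam K) - P.D (lam 0)
        + √(2 * P.LD * ∑ i, ε i) * ∑ j ∈ Finset.range K, ‖lam (j + 1) - lam j‖ := by
  have h := Finset.sum_le_sum fun k (_ : k ∈ Finset.range K) =>
    hrun.D_ascent hP hY hT hε hα k
  simp only [Finset.sum_sub_distrib, Finset.sum_add_distrib, ← Finset.mul_sum] at h
  have h1 := Finset.sum_range_sub (fun k => P.D (lam k)) K
  rw [Finset.sum_sub_distrib] at h1
  have h2 := mul_le_mul_of_nonneg_left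
    (sum_mul_window_le (g := fun j => ‖lam (j + 1) - lam j‖) (2 * k0) K) hP.LD_nonneg
  push_cast at h2
  unfold gam
  linarith

omit [Nonempty ι] in
-- Idle steps vanish, so Cauchy–Schwarz costs only the number of coordinator slots instead of k + 1.
theorem IsRun.sum_step_sq_le_card (hrun : IsRun P T ε α lam x) (k : ℕ) :
    (∑ j ∈ Finset.range (k + 1), ‖lam (j + 1) - lam j‖) ^ 2
      ≤ (slots T k).card * ∑ j ∈ Finset.range (k + 1), ‖lam (j + 1) - lam j‖ ^ 2 := by
  have h : ∑ j ∈ Finset.range (k + 1), ‖lam (j + 1) - lam j‖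
      = ∑ j ∈ slots T k, ‖lam (j + 1) - lam j‖ := by
    refine (Finset.sum_subset (slots_subset_range T k) fun j hj hk => ?_).symm
    rw [hrun.idle j fun h => hk (mem_slots.2 ⟨Finset.mem_range_succ_iff.1 hj, h⟩)]
    simp
  rw [h]
  refine sq_sum_le_card_mul_sum_sq.trans ?_
  gcongr
  exact slots_subset_range T k

omit [Nonempty ι] in
theorem IsRun.three_point_sum (hrun : IsRun P T ε α lam x) {l : Vec m} (hl : ∀ j, 0 ≤ l j)
    (k : ℕ) :
    ‖lam (k + 1) - l‖ ^ 2 + ∑ j ∈ Finset.range (k + 1), ‖lam (j + 1) - lam j‖ ^ 2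
      ≤ ‖lam 0 - l‖ ^ 2
        + ∑ κ ∈ slots T k, 2 * α * ⟪P.mul (received T x κ) - P.b, lam (κ + 1) - l⟫ := by
  classical
  have h : ∀ K, ‖lam K - l‖ ^ 2 + ∑ j ∈ Finset.range K, ‖lam (j + 1) - lam j‖ ^ 2
      ≤ ‖lam 0 - l‖ ^ 2 + ∑ κ ∈ Finset.range K,
        if κ ∈ T.KD then 2 * α * ⟪P.mul (received T x κ) - P.b, lam (κ + 1) - l⟫ else 0 := by
    intro K
    induction K with
    | zero => simp
    | succ K ih =>
      rw [Finset.sum_range_succ, Finset.sum_range_succ]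
      split_ifs with hK
      · have h := norm_proj_sub_sq_le (lam K) (P.mul (received T x K) - P.b) α hl
        rw [← hrun.update K hK] at h
        linarith
      · rw [hrun.idle K hK, sub_self, norm_zero]
        linarith
  refine (h (k + 1)).trans_eq ?_
  rw [← Finset.sum_filter]
  congr!

/-- Summed Lagrangian gaps. -/
theorem IsRun.sum_lagrangian_gap_le (hrun : IsRun P T ε α lam x) (hP : P.Regular)
    (hY : P.IsMinimizer Y) (hT : T.Bounded k0) (hα : 0 < α)
    {t C : ℝ} (ht : 0 < t) (hC : (1 + t) * (2 * k0 + 1) ^ 2 * (α * P.LD) - 1 ≤ C)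
    {l : Vec m} (hl : ∀ j, 0 ≤ l j) (k : ℕ) :
    ‖lam (k + 1) - l‖ ^ 2
      + 2 * α * ∑ κ ∈ slots T k, (P.lagrangian (received T x κ) l - P.D (lam (κ + 1)))
      ≤ ‖lam 0 - l‖ ^ 2 + 2 * α * ((1 + 1 / t) * (∑ i, ε i) * (slots T k).card)
        + C * ∑ j ∈ Finset.range (k + 1), ‖lam (j + 1) - lam j‖ ^ 2 := by
  have hL := hP.LD_nonneg
  set W : ℕ → ℝ := fun k => ∑ j ∈ Finset.Ico (k - 2 * k0) (k + 1), ‖lam (j + 1) - lam j‖ with hW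
  set S := ∑ j ∈ Finset.range (k + 1), ‖lam (j + 1) - lam j‖ ^ 2 with hS
  have hS0 : 0 ≤ S := Finset.sum_nonneg fun _ _ => sq_nonneg _
  have h1 := hrun.three_point_sum hl k
  rw [← Finset.mul_sum] at h1
  have h2 : ∀ κ ∈ slots T k, ⟪P.mul (received T x κ) - P.b, lam (κ + 1) - l⟫
      ≤ -(P.lagrangian (received T x κ) l - P.D (lam (κ + 1)))
        + ((1 + 1 / t) * (∑ i, ε i) + (1 + t) * (P.LD / 2 * W κ ^ 2)) := by
    intro κ hκ
    have hκ := (mem_slots.1 hκ).2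
    -- Comparing at the new multiplier makes the window include the current step, hence the length 2
    -- k0 + 1. The squared steps on the left of the three-point inequality pay for part of it: the
    -- -1 in `hC`.
    have h3 := hY.lagrangian_inexact_le hP (hrun.received_inexact hT hκ) (l := lam (κ + 1))
      (W := W κ) (fun i => norm_sub_le_sum_Ico lam (hT.le_source hκ i)
        ((source_le T κ i).trans κ.le_succ)) ht
    rw [← P.lagrangian_sub]
    linarith
  have h3 := Finset.sum_le_sum h2
  rw [Finset.sum_add_distrib, Finset.sum_neg_distrib, Finset.sum_add_distrib, Finset.sum_const,
    nsmul_eq_mul, ← Finset.mul_sum, ← Finset.mul_sum] at h3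
  have h4 : ∑ κ ∈ slots T k, W κ ^ 2 ≤ (2 * k0 + 1) ^ 2 * S := by
    refine (Finset.sum_le_sum_of_subset_of_nonneg (slots_subset_range T k)
      fun _ _ _ => sq_nonneg _).trans ?_
    have := sum_sq_closed_window_le (fun j => ‖lam (j + 1) - lam j‖) (2 * k0) (k + 1)
    push_cast at this
    exact this
  have h5 : (1 + t) * (P.LD / 2 * ∑ κ ∈ slots T k, W κ ^ 2)
      ≤ (1 + t) * (P.LD / 2 * ((2 * k0 + 1) ^ 2 * S)) := by gcongr
  have h6 := mul_le_mul_of_nonneg_left (h3.trans (add_le_add_right (add_le_add_right h5 _) _))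
    (by positivity : 0 ≤ 2 * α)
  have h7 := mul_le_mul_of_nonneg_right hC hS0
  linarith

end Run

/-! ### Running averages -/

section Averages

variable {ι : Type*} {m : ℕ} {n : ι → ℕ} {P : Problem ι m n} {k0 : ℕ}
  {T : Schedule ι} {ε : ι → ℝ} {α : ℝ} {lam : ℕ → Vec m} {x : ℕ → Dec n}

theorem card_slots_pos (hT : T.Bounded k0) (k : ℕ) : 0 < ((slots T k).card : ℝ) := by
  have := le_mul_card_slots hT k
  exact_mod_cast Nat.pos_of_ne_zero fun h => by simp [h] at this

theorem sum_weights_slots (hT : T.Bounded k0) (k : ℕ) :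
    ∑ _κ ∈ slots T k, 1 / ((slots T k).card : ℝ) = 1 := by
  rw [Finset.sum_const, nsmul_eq_mul]
  exact mul_one_div_cancel (card_slots_pos hT k).ne'

theorem avgX_apply (k : ℕ) (i : ι) :
    avgX T x k i = ∑ κ ∈ slots T k, (1 / ((slots T k).card : ℝ)) • received T x κ i := by
  rw [avgX, PiLp.smul_apply, WithLp.ofLp_sum, Finset.sum_apply, Finset.smul_sum]

variable [Fintype ι]

theorem IsRun.avgX_mem_region (hrun : IsRun P T ε α lam x) (hP : P.Regular) (hT : T.Bounded k0)
    (k : ℕ) : avgX T x k ∈ P.region := by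
  intro i
  rw [avgX_apply]
  exact (hP.convex i).sum_mem (fun _ _ => by positivity) (sum_weights_slots hT k)
    fun κ hκ => hrun.received_mem_region hT (mem_slots.1 hκ).2 i

theorem mul_avgX (k : ℕ) :
    P.mul (avgX T x k)
      = (1 / ((slots T k).card : ℝ)) • ∑ κ ∈ slots T k, P.mul (received T x κ) := by
  simp only [Problem.mul_eq_sum, avgX_apply, map_sum, map_smul]
  rw [Finset.sum_comm, Finset.smul_sum]
  simp only [Finset.smul_sum]

theorem IsRun.card_mul_F_avgX_le (hrun : IsRun P T ε α lam x) (hP : P.Regular)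
    (hT : T.Bounded k0) (k : ℕ) :
    (slots T k).card * P.F (avgX T x k) ≤ ∑ κ ∈ slots T k, P.F (received T x κ) := by
  have hN := card_slots_pos hT k
  have h : ∀ i, P.f i (avgX T x k i)
      ≤ ∑ κ ∈ slots T k, (1 / ((slots T k).card : ℝ)) • P.f i (received T x κ i) := by
    intro i
    rw [avgX_apply]
    exact ((hP.strongConvex i).convexOn (fun r => by
        have := hP.c_pos i; positivity)).map_sum_le (fun _ _ => by positivity)
      (sum_weights_slots hT k) fun κ hκ => hrun.received_mem_region hT (mem_slots.1 hκ).2 i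
  have h1 := Finset.sum_le_sum fun i (_ : i ∈ Finset.univ) => h i
  rw [Finset.sum_comm] at h1
  simp only [smul_eq_mul, ← Finset.mul_sum] at h1
  unfold Problem.F
  rwa [one_div, ← div_eq_inv_mul, le_div_iff₀' hN] at h1

theorem IsRun.avgLam_nonneg (hrun : IsRun P T ε α lam x) (k : ℕ) (j : Fin m) :
    0 ≤ avgLam T lam k j := by
  rw [avgLam, PiLp.smul_apply, WithLp.ofLp_sum, Finset.sum_apply, smul_eq_mul]
  have := fun κ => hrun.lam_nonneg κ j
  exact mul_nonneg (by positivity) (Finset.sum_nonneg fun κ _ => this _)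

/-- Jensen's inequality for the concave `D`: the Lagrangian at the minimizer for the averaged
multiplier is an affine majorant of `D`, exact at that average. -/
theorem sum_D_le_card_mul_D_avgLam {Y : Vec m → Dec n} (hY : P.IsMinimizer Y)
    (hT : T.Bounded k0) (lam : ℕ → Vec m) (k : ℕ) :
    ∑ κ ∈ slots T k, P.D (lam (κ + 1)) ≤ (slots T k).card * P.D (avgLam T lam k) := by
  have hN := card_slots_pos hT k
  refine (Finset.sum_le_sum fun κ _ => hY.D_le (hY.mem_region (avgLam T lam k)) _).trans_eq ?_
  rw [hY.D_eq]
  simp only [Problem.lagrangian]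
  rw [Finset.sum_add_distrib, ← sum_inner, Finset.sum_const, nsmul_eq_mul, mul_add]
  congr 1
  rw [← real_inner_smul_left]
  congr 1
  rw [avgLam, smul_smul, mul_one_div_cancel hN.ne', one_smul]

/-- The projection only increases entries and λ⁰ ≥ 0, so the multiplier dominates the accumulated
constraint violation. -/
theorem IsRun.smul_gradient_avg_le (hrun : IsRun P T ε α lam x) (hT : T.Bounded k0) (k : ℕ)
    (j : Fin m) :
    ((slots T k).card * α) * (P.mul (avgX T x k) - P.b) j ≤ lam (k + 1) j := by
  classical
  have hN := card_slots_pos hT k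
  have h : ∀ K, (∑ κ ∈ Finset.range K,
      if κ ∈ T.KD then α * (P.mul (received T x κ) - P.b) j else 0) ≤ lam K j := by
    intro K
    induction K with
    | zero => simpa using hrun.init_nonneg j
    | succ K ih =>
      rw [Finset.sum_range_succ]
      split_ifs with hK
      · have h1 := le_proj (lam K + α • (P.mul (received T x K) - P.b)) j
        rw [← hrun.update K hK, PiLp.add_apply, PiLp.smul_apply, smul_eq_mul] at h1
        linarith
      · rw [hrun.idle K hK]
        linarith
  refine le_trans (le_of_eq ?_) (h (k + 1))
  rw [← Finset.sum_filter]
  have h2 : Finset.filter (fun κ => κ ∈ T.KD) (Finset.range (k + 1)) = slots T k := by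
    unfold slots; congr!
  rw [h2, ← Finset.mul_sum, mul_avgX]
  simp only [PiLp.sub_apply, PiLp.smul_apply, WithLp.ofLp_sum, Finset.sum_apply, smul_eq_mul,
    Finset.sum_sub_distrib, Finset.sum_const, nsmul_eq_mul]
  field_simp

end Averages

end DualDecomp

namespace DualDecomp

theorem inner_le_norm_mul_norm_proj {m : ℕ} {l : Vec m} (hl : ∀ j, 0 ≤ l j) (y : Vec m) :
    ⟪l, y⟫ ≤ ‖l‖ * ‖proj y‖ := by
  refine le_trans ?_ (real_inner_le_norm l (proj y))
  rw [PiLp.inner_apply, PiLp.inner_apply]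
  refine Finset.sum_le_sum fun j _ => ?_
  simp only [RCLike.inner_apply, conj_trivial]
  exact mul_le_mul_of_nonneg_right (le_proj y j) (hl j)

/-! ### Choice of the weights and the constants of the bounds -/

section Arithmetic

theorem le_add_sqrt_of_quadratic_le {γ s a g : ℝ} (hγ : 0 < γ) (hg : 0 ≤ g)
    (ha : 0 ≤ a) (h : γ * s ^ 2 ≤ g + a * s) : s ≤ a / γ + √(g / γ) := by
  by_contra! hlt
  set q := √(g / γ) with hq
  have hq0 : 0 ≤ q := Real.sqrt_nonneg _
  have hqs : γ * q ^ 2 = g := by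
    rw [hq, Real.sq_sqrt (by positivity)]; field_simp
  have h1 : 0 ≤ a / γ := by positivity
  have h2 : γ * (a / γ + q) < γ * s := mul_lt_mul_of_pos_left hlt hγ
  have h3 : γ * (a / γ + q) = a + γ * q := by field_simp
  have h4 : 0 < s := by linarith
  have h5 : s * (γ * q) < s * (γ * s - a) := mul_lt_mul_of_pos_left (by linarith) h4
  have h6 : q * (γ * q) ≤ s * (γ * q) := mul_le_mul_of_nonneg_right (by linarith) (by positivity)
  nlinarith

/-- Here u = α L, t is the Young weight and C the coefficient of the squared steps in
`sum_lagrangian_gap_le`. The bound C ≤ 28/5 k0 serves N_{1/2}, N_1, N_1' and M_1; C ≤ 2 k0 (k0 + 1)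
and the bound on 1 / t serve M_{1/2}; the last inequality serves N_0. -/
theorem exists_weights (k0 : ℕ) {u : ℝ} (hu : 0 ≤ u) (hu1 : u * (2 * k0 + 1 / 2) < 1)
    (hu2 : u * 2 < 1) :
    ∃ t C : ℝ, 0 < t ∧ 0 ≤ C ∧ (1 + t) * (2 * k0 + 1) ^ 2 * u - 1 ≤ C ∧ C ≤ 28 / 5 * k0 ∧
      C ≤ 2 * k0 * (k0 + 1) ∧ 1 / t ≤ 2 * k0 + 1 ∧
      (1 / t - 1) * (1 - (2 * k0 + 1 / 2) * u) ^ 2 + C * u ≤ 2 * k0 * (k0 + 1) * u := by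
  rcases Nat.lt_or_ge k0 2 with h | h
  · interval_cases k0
    · refine ⟨1, 0, ?_, ?_, ?_, ?_, ?_, ?_, ?_⟩ <;> norm_num
      linarith
    · norm_num at hu1
      -- With t = 1 one needs 18 u - 1 ≤ C ≤ 4, possible only up to u = 5/18. Beyond it, t = 1/3 is
      -- the smallest weight with 1 / t ≤ 3, and the N_0 condition becomes a quadratic that is
      -- nonpositive on [5/18, 2/5].
      rcases le_total u (5 / 18) with h | h
      · refine ⟨1, 4, ?_, ?_, ?_, ?_, ?_, ?_, ?_⟩ <;> norm_num
        linarith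
      · refine ⟨1 / 3, 12 * u - 1, ?_, ?_, ?_, ?_, ?_, ?_, ?_⟩ <;> norm_num <;> nlinarith
  · have hk : (2 : ℝ) ≤ k0 := by exact_mod_cast h
    have hC : 28 / 5 * (k0 : ℝ) ≤ 2 * k0 * (k0 + 1) := by nlinarith
    -- For t = 1 the squared term of the N_0 condition drops out, leaving C ≤ 2 k0 (k0 + 1), which
    -- holds for this C once k0 ≥ 2.
    refine ⟨1, 28 / 5 * k0, one_pos, by positivity, ?_, le_rfl, hC, by norm_num, ?_⟩
    · have h1 : (1 + 1) * (2 * (k0 : ℝ) + 1) ^ 2 ≤ (28 / 5 * k0 + 1) * (2 * k0 + 1 / 2) := by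
        nlinarith
      have h2 := mul_le_mul_of_nonneg_right h1 hu
      have h3 : (28 / 5 * (k0 : ℝ) + 1) * (u * (2 * k0 + 1 / 2)) ≤ (28 / 5 * k0 + 1) * 1 :=
        mul_le_mul_of_nonneg_left hu1.le (by positivity)
      linarith
    · have := mul_le_mul_of_nonneg_right hC hu
      norm_num
      linarith

variable {k0 : ℕ} {α L e gap N K S t C : ℝ}

theorem one_div_le_of_le_mul (hN : 0 < N) (hK : 0 < K) (hKN : K ≤ (k0 + 1) * N) :
    1 / N ≤ (k0 + 1) / K := by
  rw [div_le_div_iff₀ hN hK]; linarith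

theorem one_div_sqrt_le_of_le_mul (hN : 0 < N) (hK : 0 < K) (hKN : K ≤ (k0 + 1) * N) :
    1 / √N ≤ √((k0 : ℝ) + 1) / √K := by
  rw [div_le_div_iff₀ (Real.sqrt_pos.2 hN) (Real.sqrt_pos.2 hK), one_mul,
    ← Real.sqrt_mul (by positivity)]
  exact Real.sqrt_le_sqrt hKN

theorem mul_sqrt_le_of_le (hC : C ≤ 28 / 5 * k0) :
    C * √((k0 : ℝ) + 1) ≤ 4 * k0 * (k0 + 1) := by
  have hs : √((k0 : ℝ) + 1) ^ 2 = k0 + 1 := Real.sq_sqrt (by positivity)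
  have hs0 := Real.sqrt_nonneg ((k0 : ℝ) + 1)
  have h1 : C * √((k0 : ℝ) + 1) ≤ 28 / 5 * k0 * √((k0 : ℝ) + 1) := by gcongr
  refine h1.trans ?_
  rcases Nat.eq_zero_or_pos k0 with h0 | h0
  · simp [h0]
  · have hk : (1 : ℝ) ≤ k0 := by exact_mod_cast h0
    -- The source of 28/5 = 4 · 7/5: the rational 7/5 lies just below √2.
    have h2 : 7 / 5 ≤ √((k0 : ℝ) + 1) := by
      apply Real.le_sqrt_of_sq_le; linarith
    have h3 : 28 / 5 * √((k0 : ℝ) + 1) ≤ 4 * (k0 + 1) := by nlinarith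
    nlinarith [mul_le_mul_of_nonneg_left h3 (by positivity : (0 : ℝ) ≤ k0)]

theorem constNhalf_eq (hα : 0 < α) (hL : 0 ≤ L) (he : 0 ≤ e) (hγ : 0 < gam α k0 L)
    (hgap : 0 ≤ gap) :
    constNhalf α k0 L e gap
      = 4 * k0 * (k0 + 1) * (√(2 * L * e) / gam α k0 L * √(gap / gam α k0 L)) / α := by
  have h1 : gam α k0 L ^ (3 / 2 : ℝ) = gam α k0 L * √(gam α k0 L) := by
    rw [show (3 / 2 : ℝ) = 1 + 1 / 2 by norm_num, Real.rpow_add hγ, Real.rpow_one,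
      Real.sqrt_eq_rpow]
  have := Real.sqrt_pos.2 hγ
  rw [constNhalf, h1, Real.sqrt_mul (by positivity : 0 ≤ 2 * L * e), Real.sqrt_div hgap]
  field_simp

/-- Serves both the primal gap (R = ‖λ⁰‖) and the dual gap (R = ‖λ⁰ - λ*‖). Expanding the square in
`hS` gives terms in N, √N and 1, which after division by N feed the three constants. -/
theorem averaged_gap_le {R Z : ℝ} (hα : 0 < α) (hL : 0 ≤ L) (he : 0 ≤ e)
    (hγ : 0 < gam α k0 L) (hgap : 0 ≤ gap) (hN : 0 < N) (hK : 0 < K)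
    (hKN : K ≤ (k0 + 1) * N)
    (hS : S ≤ (√(2 * L * e) * √N / gam α k0 L + √(gap / gam α k0 L)) ^ 2)
    (hC0 : 0 ≤ C) (hC1 : C ≤ 28 / 5 * k0)
    (hC : (1 / t - 1) * (1 - (2 * k0 + 1 / 2) * (α * L)) ^ 2 + C * (α * L)
      ≤ 2 * k0 * (k0 + 1) * (α * L))
    (hZ : 2 * α * (N * Z) ≤ R ^ 2 + 2 * α * ((1 + 1 / t) * e * N) + C * S) :
    Z ≤ constN0 α k0 L e + constNhalf α k0 L e gap / √K
      + (k0 + 1) / (2 * α) * (R ^ 2 + 8 * k0 * gap / gam α k0 L) / K := by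
  rw [constNhalf_eq hα hL he hγ hgap]
  have hαγ : 1 - (2 * k0 + 1 / 2) * (α * L) = α * gam α k0 L := by
    unfold gam; field_simp
  rw [hαγ] at hC
  rw [constN0]
  set γ := gam α k0 L
  set A := √(2 * L * e) / γ with hA
  set G := √(gap / γ) with hG
  have hA0 : 0 ≤ A := by positivity
  have hG0 : 0 ≤ G := Real.sqrt_nonneg _
  have hA2 : A ^ 2 = 2 * L * e / γ ^ 2 := by
    rw [hA, div_pow, Real.sq_sqrt (by positivity)]
  have hG2 : G ^ 2 = gap / γ := Real.sq_sqrt (by positivity)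
  have hsN : √N ^ 2 = N := Real.sq_sqrt hN.le
  have hsN0 := Real.sqrt_pos.2 hN
  have hS' : C * S ≤ C * (A ^ 2 * N + 2 * (A * G) * √N + G ^ 2) := by
    refine mul_le_mul_of_nonneg_left (hS.trans_eq ?_) hC0
    have h1 : √(2 * L * e) * √N / γ = A * √N := by rw [hA]; ring
    rw [h1, add_sq, mul_pow, hsN]
    ring
  have hZ' : Z ≤ ((1 + 1 / t) * e + C * A ^ 2 / (2 * α)) + C * (A * G) / α * (1 / √N)
      + (R ^ 2 + C * G ^ 2) / (2 * α) * (1 / N) := by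
    have h1 : 2 * α * (N * Z) ≤ 2 * α * (N * (((1 + 1 / t) * e + C * A ^ 2 / (2 * α))
        + C * (A * G) / α * (1 / √N) + (R ^ 2 + C * G ^ 2) / (2 * α) * (1 / N))) := by
      refine (hZ.trans (add_le_add_right hS' _)).trans_eq ?_
      have h2 : N * (1 / √N) = √N := by field_simp; exact hsN.symm
      have h3 : 2 * α * (N * (((1 + 1 / t) * e + C * A ^ 2 / (2 * α))
        + C * (A * G) / α * (1 / √N) + (R ^ 2 + C * G ^ 2) / (2 * α) * (1 / N)))
        = 2 * α * (N * ((1 + 1 / t) * e + C * A ^ 2 / (2 * α)) + C * (A * G) / α * (N * (1 / √N))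
          + (R ^ 2 + C * G ^ 2) / (2 * α) * (N * (1 / N))) := by ring
      rw [h3, h2, mul_one_div_cancel hN.ne']
      field_simp
      ring
    exact le_of_mul_le_mul_left (le_of_mul_le_mul_left h1 (by positivity)) hN
  -- This is `hC` times e / (α γ)², since 1 - (2 k0 + 1/2) α L = α γ.
  have hp1 : (1 + 1 / t) * e + C * A ^ 2 / (2 * α)
      ≤ 2 * e + 2 * k0 * (k0 + 1) * L * e / (α * γ ^ 2) := by
    have h1 := mul_le_mul_of_nonneg_right hC (by positivity : 0 ≤ e / (α * γ) ^ 2)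
    have h2 : ((1 / t - 1) * (α * γ) ^ 2 + C * (α * L)) * (e / (α * γ) ^ 2)
        = (1 / t - 1) * e + C * A ^ 2 / (2 * α) := by
      rw [hA2]
      have h3 : ((1 / t - 1) * (α * γ) ^ 2 + C * (α * L)) * (e / (α * γ) ^ 2)
        = (1 / t - 1) * e * ((α * γ) ^ 2 / (α * γ) ^ 2) + C * (α * L) * e / (α * γ) ^ 2 := by ring
      rw [h3, div_self (by positivity)]
      field_simp
    have h3 : 2 * k0 * (k0 + 1) * (α * L) * (e / (α * γ) ^ 2)
        = 2 * k0 * (k0 + 1) * L * e / (α * γ ^ 2) := by field_simp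
    rw [h2, h3] at h1
    linarith
  have hp2 : C * (A * G) / α * (1 / √N) ≤ 4 * k0 * (k0 + 1) * (A * G) / α / √K := by
    calc C * (A * G) / α * (1 / √N)
        ≤ C * (A * G) / α * (√((k0 : ℝ) + 1) / √K) := by
          exact mul_le_mul_of_nonneg_left (one_div_sqrt_le_of_le_mul hN hK hKN) (by positivity)
      _ = C * √((k0 : ℝ) + 1) * ((A * G) / α / √K) := by ring
      _ ≤ 4 * k0 * (k0 + 1) * ((A * G) / α / √K) := by
          exact mul_le_mul_of_nonneg_right (mul_sqrt_le_of_le hC1) (by positivity)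
      _ = _ := by ring
  have hp3 : (R ^ 2 + C * G ^ 2) / (2 * α) * (1 / N)
      ≤ (k0 + 1) / (2 * α) * (R ^ 2 + 8 * k0 * gap / γ) / K := by
    have h8 : C * G ^ 2 ≤ 8 * k0 * gap / γ := by
      rw [hG2, mul_div_assoc]
      refine mul_le_mul_of_nonneg_right (hC1.trans ?_) (by positivity)
      have : (0 : ℝ) ≤ k0 := by positivity
      linarith
    calc (R ^ 2 + C * G ^ 2) / (2 * α) * (1 / N)
        ≤ (R ^ 2 + 8 * k0 * gap / γ) / (2 * α) * ((k0 + 1) / K) := by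
          exact mul_le_mul (by gcongr) (one_div_le_of_le_mul hN hK hKN) (by positivity)
            (by positivity)
      _ = _ := by ring
  linarith

/-- The square root of a sum of squares is at most the sum of the roots, so d is at most r plus a
tolerance term and a step term. The triangle inequality at λ* is used twice, whence 2 ‖λ*‖ + ‖λ⁰‖ in
M_1. -/
theorem averaged_infeasibility_le {v d Λ ls l0 r : ℝ} (hα : 0 < α) (hL : 0 ≤ L) (he : 0 ≤ e)
    (hγ : 0 < gam α k0 L) (hgap : 0 ≤ gap) (hN : 0 < N) (hK : 0 < K)
    (hKN : K ≤ (k0 + 1) * N)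
    (hS : S ≤ (√(2 * L * e) * √N / gam α k0 L + √(gap / gam α k0 L)) ^ 2)
    (ht : 1 / t ≤ 2 * k0 + 1)
    (hC0 : 0 ≤ C) (hC1 : C ≤ 28 / 5 * k0) (hC2 : C ≤ 2 * k0 * (k0 + 1))
    (hls : 0 ≤ ls) (hl0 : 0 ≤ l0) (hr0 : 0 ≤ r) (hr : r ≤ l0 + ls)
    (hv : N * α * v ≤ Λ) (hΛ : Λ ≤ d + ls)
    (hd : d ^ 2 ≤ r ^ 2 + 2 * α * ((1 + 1 / t) * e * N) + C * S) :
    v ≤ constMhalf α k0 L e / √K + constM1 α k0 L gap ls l0 / K := by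
  rw [constMhalf, constM1]
  set γ := gam α k0 L
  set G := √(gap / γ) with hG
  have hG0 : 0 ≤ G := Real.sqrt_nonneg _
  set X := 2 * √(α * e) + 2 * √(k0 * L * e) / γ with hX
  set M := 2 * ls + l0 + 2 * √(2 * k0 * gap / γ) with hM
  set s := √((k0 : ℝ) + 1) with hs
  have hs2 : s ^ 2 = k0 + 1 := Real.sq_sqrt (by positivity)
  have hs0 : 0 ≤ s := Real.sqrt_nonneg _
  have hsN : √N ^ 2 = N := Real.sq_sqrt hN.le
  have hsN0 := Real.sqrt_pos.2 hN
  have hk : (0 : ℝ) ≤ k0 := by positivity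
  have hX0 : 0 ≤ X := by positivity
  have hM0 : 0 ≤ M := by positivity
  have h1 : 2 * α * ((1 + 1 / t) * e * N) ≤ (2 * √(α * e) * (s * √N)) ^ 2 := by
    have : (2 * √(α * e) * (s * √N)) ^ 2 = 4 * (k0 + 1) * (α * e * N) := by
      rw [mul_pow, mul_pow, mul_pow, hs2, hsN, Real.sq_sqrt (by positivity)]; ring
    rw [this]
    have := mul_le_mul_of_nonneg_right ht (by positivity : 0 ≤ α * e * N)
    linarith
  have h2 : √C * (√(2 * L * e) * √N / γ) ≤ 2 * √(k0 * L * e) / γ * (s * √N) := by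
    have : √C * √(2 * L * e) ≤ 2 * √(k0 * L * e) * s := by
      refine le_of_sq_le_sq ?_ (by positivity)
      rw [mul_pow, mul_pow, mul_pow, hs2, Real.sq_sqrt hC0, Real.sq_sqrt (by positivity),
        Real.sq_sqrt (by positivity)]
      have := mul_le_mul_of_nonneg_right hC2 (by positivity : 0 ≤ 2 * L * e)
      linarith
    calc _ = √C * √(2 * L * e) * (√N / γ) := by ring
      _ ≤ 2 * √(k0 * L * e) * s * (√N / γ) := by gcongr
      _ = _ := by ring
  have h3 : √C * G ≤ 2 * √(2 * k0 * gap / γ) := by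
    refine le_of_sq_le_sq ?_ (by positivity)
    rw [mul_pow, mul_pow, Real.sq_sqrt hC0, Real.sq_sqrt (by positivity),
      Real.sq_sqrt (by positivity)]
    have : C * (gap / γ) ≤ 8 * k0 * (gap / γ) :=
      mul_le_mul_of_nonneg_right (by linarith) (by positivity)
    refine this.trans_eq (by ring)
  have h4 : C * S ≤ (√C * (√(2 * L * e) * √N / γ + G)) ^ 2 := by
    rw [mul_pow, Real.sq_sqrt hC0]
    exact mul_le_mul_of_nonneg_left hS hC0
  have h5 : d ≤ r + 2 * √(α * e) * (s * √N) + √C * (√(2 * L * e) * √N / γ + G) := by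
    set p := 2 * √(α * e) * (s * √N)
    set q := √C * (√(2 * L * e) * √N / γ + G)
    have hp : 0 ≤ p := by positivity
    have hq : 0 ≤ q := by positivity
    refine le_of_sq_le_sq ?_ (by positivity)
    nlinarith [mul_nonneg hr0 hp, mul_nonneg hr0 hq, mul_nonneg hp hq]
  have h6 : N * α * v ≤ M + X * (s * √N) := by
    rw [hM, hX]; linarith
  have h7 : v ≤ M / α * (1 / N) + X / α * s * (1 / √N) := by
    have h8 : N * α * (M / α * (1 / N) + X / α * s * (1 / √N)) = M + X * (s * √N) := by
      have h9 : N * (1 / √N) = √N := by field_simp; exact hsN.symm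
      calc _ = M * (α / α) * (N * (1 / N)) + X * (α / α) * s * (N * (1 / √N)) := by ring
        _ = _ := by rw [h9, mul_one_div_cancel hN.ne', div_self hα.ne']; ring
    rw [← h8] at h6
    exact le_of_mul_le_mul_left h6 (by positivity)
  calc v ≤ M / α * (1 / N) + X / α * s * (1 / √N) := h7
    _ ≤ M / α * ((k0 + 1) / K) + X / α * s * (s / √K) := by
        refine add_le_add (mul_le_mul_of_nonneg_left ?_ (by positivity))
          (mul_le_mul_of_nonneg_left ?_ (by positivity))
        · exact one_div_le_of_le_mul hN hK hKN
        · exact one_div_sqrt_le_of_le_mul hN hK hKN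
    _ = M / α * ((k0 + 1) / K) + X / α * s ^ 2 / √K := by ring
    _ = _ := by rw [hs2]; ring

end Arithmetic

theorem IsRun.sum_step_sq_le_sq {ι : Type*} [Fintype ι] [Nonempty ι] {m : ℕ} {n : ι → ℕ}
    {P : Problem ι m n} {k0 : ℕ} {T : Schedule ι} {ε : ι → ℝ} {α : ℝ} {lam : ℕ → Vec m}
    {x : ℕ → Dec n} {Y : Vec m → Dec n} {ls : Vec m}
    (hrun : IsRun P T ε α lam x) (hP : P.Regular) (hY : P.IsMinimizer Y) (hT : T.Bounded k0)
    (hε : ∀ i, 0 ≤ ε i) (hα : 0 < α) (hγ : 0 < gam α k0 P.LD) (hls : P.IsDualOptimal ls)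
    (k : ℕ) :
    ∑ j ∈ Finset.range (k + 1), ‖lam (j + 1) - lam j‖ ^ 2
      ≤ (√(2 * P.LD * ∑ i, ε i) * √((slots T k).card : ℝ) / gam α k0 P.LD
        + √((P.D ls - P.D (lam 0)) / gam α k0 P.LD)) ^ 2 := by
  set S := ∑ j ∈ Finset.range (k + 1), ‖lam (j + 1) - lam j‖ ^ 2 with hS
  have hS0 : 0 ≤ S := Finset.sum_nonneg fun _ _ => sq_nonneg _
  have h1 := hrun.sum_step_sq_le hP hY hT hε hα (k + 1)
  have h2 : ∑ j ∈ Finset.range (k + 1), ‖lam (j + 1) - lam j‖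
      ≤ √((slots T k).card : ℝ) * √S := by
    rw [← Real.sqrt_mul (by positivity)]
    exact Real.le_sqrt_of_sq_le (hrun.sum_step_sq_le_card k)
  have h3 := hls.2 _ (hrun.lam_nonneg (k + 1))
  have h4 := hls.2 _ (hrun.lam_nonneg 0)
  have h5 := mul_le_mul_of_nonneg_left h2 (Real.sqrt_nonneg (2 * P.LD * ∑ i, ε i))
  have h6 := le_add_sqrt_of_quadratic_le (s := √S)
    (a := √(2 * P.LD * ∑ i, ε i) * √((slots T k).card : ℝ)) hγ (sub_nonneg.2 h4) (by positivity)
    (by rw [Real.sq_sqrt hS0]; linarith)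
  calc S = √S ^ 2 := (Real.sq_sqrt hS0).symm
    _ ≤ _ := pow_le_pow_left₀ (Real.sqrt_nonneg _) h6 2

end DualDecomp

/-! ### The convergence bounds -/

theorem theorem3 {ι : Type*} [Fintype ι] [Nonempty ι] {m : ℕ} {n : ι → ℕ}
    (P : DualDecomp.Problem ι m n) (hP : P.Regular)
    (k0 : ℕ) (T : DualDecomp.Schedule ι) (hT : T.Bounded k0)
    (ε : ι → ℝ) (hε : ∀ i, 0 ≤ ε i)
    (α : ℝ) (hα : 0 < α)
    (hα1 : α * ((2 * k0 + 1 / 2) * P.LD) < 1) (hα2 : α * (2 * P.LD) < 1)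
    (lam : ℕ → DualDecomp.Vec m) (x : ℕ → DualDecomp.Dec n)
    (hrun : DualDecomp.IsRun P T ε α lam x)
    (xs : DualDecomp.Dec n) (hxs : P.IsPrimalOptimal xs)
    (ls : DualDecomp.Vec m) (hls : P.IsDualOptimal ls)
    (Mhalf M1 N0 Nhalf N1 N1' : ℝ)
    (hMhalf : Mhalf = DualDecomp.constMhalf α k0 P.LD (∑ i, ε i))
    (hM1 : M1 = DualDecomp.constM1 α k0 P.LD (P.D ls - P.D (lam 0)) ‖ls‖ ‖lam 0‖)
    (hN0 : N0 = DualDecomp.constN0 α k0 P.LD (∑ i, ε i))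
    (hNhalf : Nhalf =
      DualDecomp.constNhalf α k0 P.LD (∑ i, ε i) (P.D ls - P.D (lam 0)))
    (hN1 : N1 = DualDecomp.constN1 α k0 P.LD (P.D ls - P.D (lam 0)) ‖lam 0‖)
    (hN1' : N1' = DualDecomp.constN1' α k0 P.LD (P.D ls - P.D (lam 0)) ‖lam 0 - ls‖)
    (k : ℕ) :
    ‖DualDecomp.proj (P.mul (DualDecomp.avgX T x k) - P.b)‖
        ≤ Mhalf / √((k : ℝ) + 1) + M1 / ((k : ℝ) + 1) ∧
    (-(Mhalf * ‖ls‖ / √((k : ℝ) + 1)) - M1 * ‖ls‖ / ((k : ℝ) + 1)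
        ≤ P.F (DualDecomp.avgX T x k) - P.F xs ∧
      P.F (DualDecomp.avgX T x k) - P.F xs
        ≤ N0 + Nhalf / √((k : ℝ) + 1) + N1 / ((k : ℝ) + 1)) ∧
    (0 ≤ P.D ls - P.D (DualDecomp.avgLam T lam k) ∧
      P.D ls - P.D (DualDecomp.avgLam T lam k)
        ≤ N0 + Nhalf / √((k : ℝ) + 1) + N1' / ((k : ℝ) + 1)) ∧
    ‖DualDecomp.avgX T x k - xs‖ ^ 2
        ≤ 2 * N0 / P.cF + 2 * (Nhalf + ‖ls‖ * Mhalf) / (P.cF * √((k : ℝ) + 1))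
          + 2 * (N1 + ‖ls‖ * M1) / (P.cF * ((k : ℝ) + 1)) := by
  have hγ : 0 < DualDecomp.gam α k0 P.LD := by
    have h : DualDecomp.gam α k0 P.LD = (1 - α * ((2 * k0 + 1 / 2) * P.LD)) / α := by
      unfold DualDecomp.gam; field_simp
    rw [h]
    exact div_pos (by linarith) hα
  have hL := hP.LD_nonneg
  have hcF := hP.cF_pos
  have he : 0 ≤ ∑ i, ε i := Finset.sum_nonneg fun i _ => hε i
  obtain ⟨Y, hY⟩ := hP.exists_isMinimizer
  have hgap : 0 ≤ P.D ls - P.D (lam 0) := sub_nonneg.2 (hls.2 _ (hrun.lam_nonneg 0))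
  have hN := DualDecomp.card_slots_pos hT k
  have hK : (0 : ℝ) < (k : ℝ) + 1 := by positivity
  have hKN : (k : ℝ) + 1 ≤ (k0 + 1) * ((DualDecomp.slots T k).card : ℝ) := by
    exact_mod_cast DualDecomp.le_mul_card_slots hT k
  have hS := hrun.sum_step_sq_le_sq hP hY hT hε hα hγ hls k
  have hdual := hY.strong_duality hP hxs hls
  have hxbar := hrun.avgX_mem_region hP hT k
  obtain ⟨t, C, ht, hC0, hC, hC1, hC2, ht1, hC3⟩ := DualDecomp.exists_weights k0
    (u := α * P.LD) (by positivity) (by linarith) (by linarith)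
  have hopt : ∀ κ, P.D (lam (κ + 1)) ≤ P.D ls := fun κ => hls.2 _ (hrun.lam_nonneg _)
  have hgapls := hrun.sum_lagrangian_gap_le hP hY hT hα ht hC hls.1 k
  have hsumls : ((DualDecomp.slots T k).card : ℝ)
      * (P.D ls - P.D (DualDecomp.avgLam T lam k))
      ≤ ∑ κ ∈ DualDecomp.slots T k,
        (P.lagrangian (DualDecomp.received T x κ) ls - P.D (lam (κ + 1))) := by
    have h1 := DualDecomp.sum_D_le_card_mul_D_avgLam hY hT lam k
    have h2 := Finset.card_nsmul_le_sum (DualDecomp.slots T k)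
      (fun κ => P.lagrangian (DualDecomp.received T x κ) ls) (P.D ls) fun κ hκ =>
        hY.D_le (hrun.received_mem_region hT (DualDecomp.mem_slots.1 hκ).2) ls
    rw [nsmul_eq_mul] at h2
    rw [Finset.sum_sub_distrib]
    linarith
  have hc0 : 0 ≤ P.D ls - P.D (DualDecomp.avgLam T lam k) :=
    sub_nonneg.2 (hls.2 _ (hrun.avgLam_nonneg k))
  have hc : P.D ls - P.D (DualDecomp.avgLam T lam k)
      ≤ N0 + Nhalf / √((k : ℝ) + 1) + N1' / ((k : ℝ) + 1) := by
    rw [hN0, hNhalf, hN1', DualDecomp.constN1']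
    refine DualDecomp.averaged_gap_le hα hL he hγ hgap hN hK hKN hS hC0 hC1 hC3 ?_
    refine le_trans ?_ hgapls
    have := mul_le_mul_of_nonneg_left hsumls (by positivity : 0 ≤ 2 * α)
    linarith [sq_nonneg ‖lam (k + 1) - ls‖]
  have ha : ‖DualDecomp.proj (P.mul (DualDecomp.avgX T x k) - P.b)‖
      ≤ Mhalf / √((k : ℝ) + 1) + M1 / ((k : ℝ) + 1) := by
    rw [hMhalf, hM1]
    refine DualDecomp.averaged_infeasibility_le (d := ‖lam (k + 1) - ls‖)
      (Λ := ‖lam (k + 1)‖) (r := ‖lam 0 - ls‖) hα hL he hγ hgap hN hK hKN hS ht1 hC0 hC1 hC2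
      (norm_nonneg _) (norm_nonneg _) (norm_nonneg _) (norm_sub_le _ _) ?_ ?_ ?_
    · have hNα : 0 < ((DualDecomp.slots T k).card : ℝ) * α := by positivity
      have h := DualDecomp.norm_proj_le_of_le
        (y := P.mul (DualDecomp.avgX T x k) - P.b)
        (z := (((DualDecomp.slots T k).card : ℝ) * α)⁻¹ • lam (k + 1))
        (fun j => by
          rw [PiLp.smul_apply, smul_eq_mul]
          exact mul_nonneg (by positivity) (hrun.lam_nonneg _ j))
        (fun j => by
          rw [PiLp.smul_apply, smul_eq_mul, ← div_eq_inv_mul, le_div_iff₀' hNα]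
          exact hrun.smul_gradient_avg_le hT k j)
      rwa [norm_smul, Real.norm_of_nonneg (by positivity), ← div_eq_inv_mul,
        le_div_iff₀' hNα] at h
    · simpa using norm_add_le (lam (k + 1) - ls) ls
    -- At l = λ* the summed gaps are nonnegative, so they can be dropped to leave a bound on
    -- ‖λ^{k+1} - λ*‖².
    · have h1 : 0 ≤ 2 * α * ∑ κ ∈ DualDecomp.slots T k,
          (P.lagrangian (DualDecomp.received T x κ) ls - P.D (lam (κ + 1))) :=
        mul_nonneg (by positivity) ((mul_nonneg hN.le hc0).trans hsumls)
      linarith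
  have hbu : P.F (DualDecomp.avgX T x k) - P.F xs
      ≤ N0 + Nhalf / √((k : ℝ) + 1) + N1 / ((k : ℝ) + 1) := by
    rw [hN0, hNhalf, hN1, DualDecomp.constN1]
    refine DualDecomp.averaged_gap_le hα hL he hγ hgap hN hK hKN hS hC0 hC1 hC3 ?_
    have h1 := hrun.sum_lagrangian_gap_le hP hY hT hα ht hC (l := 0) (fun j => by simp) k
    simp only [P.lagrangian_zero, sub_zero] at h1
    refine le_trans ?_ h1
    have h2 := hrun.card_mul_F_avgX_le hP hT k
    have h3 := Finset.sum_le_card_nsmul (DualDecomp.slots T k)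
      (fun κ => P.D (lam (κ + 1))) (P.D ls) fun κ _ => hopt κ
    rw [nsmul_eq_mul, hdual] at h3
    have h4 : ((DualDecomp.slots T k).card : ℝ) * (P.F (DualDecomp.avgX T x k) - P.F xs)
        ≤ ∑ κ ∈ DualDecomp.slots T k,
          (P.F (DualDecomp.received T x κ) - P.D (lam (κ + 1))) := by
      rw [Finset.sum_sub_distrib]
      linarith
    have := mul_le_mul_of_nonneg_left h4 (by positivity : 0 ≤ 2 * α)
    linarith [sq_nonneg ‖lam (k + 1)‖]
  have hinner : ⟪ls, P.mul (DualDecomp.avgX T x k) - P.b⟫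
      ≤ ‖ls‖ * (Mhalf / √((k : ℝ) + 1) + M1 / ((k : ℝ) + 1)) :=
    (DualDecomp.inner_le_norm_mul_norm_proj hls.1 _).trans
      (mul_le_mul_of_nonneg_left ha (norm_nonneg _))
  refine ⟨ha, ⟨?_, hbu⟩, ⟨hc0, hc⟩, ?_⟩
  · have h1 := hY.D_le hxbar ls
    rw [hdual, DualDecomp.Problem.lagrangian] at h1
    calc -(Mhalf * ‖ls‖ / √((k : ℝ) + 1)) - M1 * ‖ls‖ / ((k : ℝ) + 1)
        = -(‖ls‖ * (Mhalf / √((k : ℝ) + 1) + M1 / ((k : ℝ) + 1))) := by ring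
      _ ≤ _ := by linarith
  -- x* is the Lagrangian minimizer at λ*, so strong convexity bounds the squared distance by the
  -- primal gap plus ⟪λ*, A x̄ - b⟫.
  · have h1 := hY.D_add_le hP hxbar ls
    rw [← hY.eq_of_optimal hP hxs hls, hdual, DualDecomp.Problem.lagrangian] at h1
    have h2 : P.cF / 2 * ‖DualDecomp.avgX T x k - xs‖ ^ 2
        ≤ N0 + Nhalf / √((k : ℝ) + 1) + N1 / ((k : ℝ) + 1)
          + ‖ls‖ * (Mhalf / √((k : ℝ) + 1) + M1 / ((k : ℝ) + 1)) := by linarith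
    have h3 : ‖DualDecomp.avgX T x k - xs‖ ^ 2
        ≤ (N0 + Nhalf / √((k : ℝ) + 1) + N1 / ((k : ℝ) + 1)
          + ‖ls‖ * (Mhalf / √((k : ℝ) + 1) + M1 / ((k : ℝ) + 1))) / (P.cF / 2) := by
      rw [le_div_iff₀' (by positivity)]
      exact h2
    refine h3.trans_eq ?_
    field_simp
    ring
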